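/- **Model.** Let $d,T\ge 1$. A seller faces periods $t=1,\dots,T$. In period $t$ a covariate vector $x_t\in\mathcal X\subseteq\mathbb R^d$ is observed, a price $p_t$ is set, and the demand is $D_t=g(x_t^\top\beta^*+x_t^\top\gamma^*p_t)+\epsilon_t$, with unknown $\theta^*=(\beta^*,\gamma^*)\in\mathbb R^{2d}$; the revenue is $p_tD_t$. For $\theta=(\beta,\gamma)$ put $r(p;\theta,x)=p\,g(x^\top\beta+x^\top\gamma p)$, $r^*(\theta,x)=\max_{p\ge 0}r(p;\theta,x)$, and let $p^*(\theta,x)\in\arg\max_{p\ge0}r(p;\theta,x)$. Write $z_t=(x_t,p_tx_t)\in\mathbb R^{2d}$ and $\|v\|_M=\sqrt{v^\top Mv}$. **Assumptions.** (1) $\Theta\subset\mathbb R^{2d}$ is convex, $\|\theta\|_2\le\bar\theta$ on $\Theta$ for some $\bar\theta>0$ (for instance, $\Theta$ is the whole ball of radius $\bar\theta$), and $\theta^*\in\Theta$; for all $\theta\in\Theta$, $x\in\mathcal X$ the maximizer $p^*(\theta,x)$ exists and lies in $(\underline p,\bar p)$; $\|(x,px)\|_2\le 1$ for $x\in\mathcal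 X$, $p\in[\underline p,\bar p]$. (2) $g:\mathbb R\to\mathbb R$ is strictly increasing and differentiable, and $0<\underline g\le g'(x^\top\beta+x^\top\gamma p)\le\bar g$ for all $x\in\mathcal X$, $(\beta,\gamma)\in\Theta$, $p\in[\underline p,\bar p]$. (3) There are $\bar\sigma>0$ and a filtration $(\mathcal F_t)_{t\ge0}$ such that, for $t=1,\dots,T$, $x_t$ and $p_t$ are $\mathcal F_{t-1}$-measurable (the pricing does not anticipate; the covariates may be arbitrary, deterministic or adaptively chosen), $\epsilon_t$ is $\mathcal F_t$-measurable, $\mathbb E[\epsilon_t\mid\mathcal F_{t-1}]=0$ and $\mathbb E[e^{s\epsilon_t}\mid\mathcal F_{t-1}]\le e^{\bar\sigma^2s^2/2}$ for all $s\in\mathbb R$. (For instance, $\mathcal F_t$ is generated by $p_1,\dots,p_t,\epsilon_1,\dots,\epsilon_t,x_1,\dots,x_{t+1}$.) **Algorithm (UCB pricing with approximation, regularization $\lambda=1$).** Let $l_t(\theta)=-\int_{D_t}^{g(z_t^\top\theta)}\frac{u-D_t}{h(u)}\,du$ with $h(u)=g'(g^{-1}(u))$, these integrals being assumed to converge absolutely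 for $\theta\in\Theta$ almost surely (the values of $h$ outside the range of $g$ are immaterial). Let $\hat\theta_t$ maximize $L_t(\theta)=-\underline g\|\theta\|_2^2+\sum_{\tau=1}^tl_\tau(\theta)$ over $\Theta$, let $\check\theta_t\in\Theta$ be an approximate maximizer, and let $\Delta_t$ be its optimality gap $L_t(\hat\theta_t)-L_t(\check\theta_t)$ or any upper bound for it; $\Delta_t$ may be random. Put $M_t=I_{2d}+\sum_{\tau=1}^tz_\tau z_\tau^\top$ and $$\alpha(M)=2\bar\theta+\frac{2\bar\sigma}{\underline g}\sqrt{2\log T+\log\det M}.$$ In period $t$ the algorithm forms $$\Theta_t=\Big\{\theta\in\Theta:\ \|\theta-\check\theta_{t-1}\|_{M_{t-1}}\le\alpha(M_{t-1})+\sqrt{\tfrac{2}{\underline g}\Delta_{t-1}}\Big\},$$ chooses $\theta_t\in\arg\max_{\theta\in\Theta_t}r^*(\theta,x_t)$ and sets $p_t=p^*(\theta_t,x_t)$. **Theorem.** Let $\mathrm{Reg}_T=\mathbb E\big[\sum_{t=1}^Tr^*(\theta^*,x_t)\big]-\mathbb E\big[\sum_{t=1}^Tp_tD_t\big]$ (for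 deterministic covariates the first expectation is just the sum) and $$\bar\alpha=2\bar\theta+\frac{2\bar\sigma}{\underline g}\sqrt{2\log T+2d\log\Big(\frac{2d+T}{2d}\Big)}.$$ If the variables $\sqrt{\Delta_{t-1}}\,\|z_t\|_{M_{t-1}^{-1}}$, $1\le t\le T$, are integrable (automatic when the $\Delta_t$ are deterministic), then $$\mathrm{Reg}_T\le4\bar p\bar g\left(\bar\alpha\sqrt{Td\log\Big(\frac{2d+T}{2d}\Big)}+\frac{\sqrt2}{2\sqrt{\underline g}}\sum_{t=1}^T\mathbb E\Big[\sqrt{\Delta_{t-1}}\,\|z_t\|_{M_{t-1}^{-1}}\Big]\right)+\bar p,$$ where $\mathbb E[\sqrt{\Delta_{t-1}}\|z_t\|_{M_{t-1}^{-1}}]=\sqrt{\Delta_{t-1}}\,\mathbb E\|z_t\|_{M_{t-1}^{-1}}$ for deterministic $\Delta_{t-1}$. Moreover, if $\Delta_{t-1}\le\bar\Delta$ almost surely for all $t=1,\dots,T$ and a constant $\bar\Delta$, then (with no integrability condition) $$\mathrm{Reg}_T\le4\bar p\bar g\left(\bar\alpha+\sqrt{\frac{2\bar\Delta}{\underline g}}\right)\sqrt{Td\log\Big(\frac{2d+T}{2d}\Big)}+\bar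 p.$$ -/

import Mathlib

open MeasureTheory
open scoped Matrix

noncomputable section

/-- Covariates: vectors of `ℝ^d` with the Euclidean norm. -/
abbrev Covariate (d : ℕ) : Type := EuclideanSpace ℝ (Fin d)

/-- Parameters `θ = (β, γ) ∈ ℝ^(2d)` with the Euclidean norm; `β` is the left block of
coordinates and `γ` the right block. -/
abbrev Param (d : ℕ) : Type := EuclideanSpace ℝ (Fin d ⊕ Fin d)

/-- The linear predictor `xᵀβ + xᵀγ · p`. -/
def linPred {d : ℕ} (θ : Param d) (x : Covariate d) (p : ℝ) : ℝ :=
  (∑ i, x i * θ (Sum.inl i)) + (∑ i, x i * θ (Sum.inr i)) * p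

/-- The concatenated vector `z = (x, p x)`. -/
def feature {d : ℕ} (x : Covariate d) (p : ℝ) : Param d :=
  WithLp.toLp 2 (Sum.elim (fun i => x i) (fun i => p * x i))

/-- `zᵀθ = xᵀβ + xᵀγ · p` for `z = (x, p x)`. -/
theorem inner_feature {d : ℕ} (θ : Param d) (x : Covariate d) (p : ℝ) :
    inner ℝ (feature x p) θ = linPred θ x p := by
  simp only [feature, linPred, PiLp.inner_apply, Fintype.sum_sum_type, Sum.elim_inl, Sum.elim_inr,
    Finset.sum_mul, RCLike.inner_apply, conj_trivial]
  congr 1 <;> exact Finset.sum_congr rfl fun i _ => by ring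

/-- Expected revenue `r(p; θ, x) = p · g(xᵀβ + xᵀγ · p)`. -/
def revenue {d : ℕ} (g : ℝ → ℝ) (p : ℝ) (θ : Param d) (x : Covariate d) : ℝ :=
  p * g (linPred θ x p)

/-- Optimal expected revenue `r*(θ, x) = max_{p ≥ 0} r(p; θ, x)`. -/
def optRevenue {d : ℕ} (g : ℝ → ℝ) (θ : Param d) (x : Covariate d) : ℝ :=
  sSup ((fun p => revenue g p θ x) '' Set.Ici 0)

/-- `pstar` is an optimal pricing function `p*(θ, x) ∈ argmax_{p ≥ 0} r(p; θ, x)` for the parameters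
in `Θ` and the covariates in `𝒳`. -/
def IsOptimalPricing {d : ℕ} (g : ℝ → ℝ) (Θ : Set (Param d)) (𝒳 : Set (Covariate d))
    (pstar : Param d → Covariate d → ℝ) : Prop :=
  ∀ θ ∈ Θ, ∀ x ∈ 𝒳, 0 ≤ pstar θ x ∧
    IsMaxOn (fun p => revenue g p θ x) (Set.Ici 0) (pstar θ x)

/-- Demand `D = g(xᵀβ + xᵀγ · p) + ε`. -/
def demand {d : ℕ} (g : ℝ → ℝ) (θ : Param d) (x : Covariate d) (p ε : ℝ) : ℝ :=
  g (linPred θ x p) + ε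

/-- `h(u) = g'(g⁻¹(u))`. -/
def linkWeight (g : ℝ → ℝ) (u : ℝ) : ℝ := deriv g (Function.invFun g u)

/-- The integrand `(u - D) / h(u)` of the misspecified likelihood. -/
def likIntegrand (g : ℝ → ℝ) (D u : ℝ) : ℝ := (1 / linkWeight g u) * (u - D)

/-- The misspecified likelihood `l(θ) = -∫_D^{g(zᵀθ)} (u - D) / h(u) du` of the observation
`(z, D)`. -/
def quasiLik {d : ℕ} (g : ℝ → ℝ) (z : Param d) (D : ℝ) (θ : Param d) : ℝ :=
  -∫ u in D..(g (inner ℝ z θ)), likIntegrand g D u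

/-- The regularized objective `-λ g̲ ‖θ‖² + ∑_{τ=1}^t l_τ(θ)`. -/
def quasiObjective {d : ℕ} (g : ℝ → ℝ) (lam glow : ℝ) (z : ℕ → Param d) (D : ℕ → ℝ) (t : ℕ)
    (θ : Param d) : ℝ :=
  -lam * glow * ‖θ‖ ^ 2 + ∑ τ ∈ Finset.Icc 1 t, quasiLik g (z τ) (D τ) θ

/-- `M_t = λ I + ∑_{τ=1}^t z_τ z_τᵀ`. -/
def designMatrix {d : ℕ} (lam : ℝ) (z : ℕ → Param d) (t : ℕ) :
    Matrix (Fin d ⊕ Fin d) (Fin d ⊕ Fin d) ℝ :=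
  lam • (1 : Matrix (Fin d ⊕ Fin d) (Fin d ⊕ Fin d) ℝ) +
    ∑ τ ∈ Finset.Icc 1 t, Matrix.vecMulVec (WithLp.ofLp (z τ)) (WithLp.ofLp (z τ))

/-- `‖v‖_M = √(vᵀ M v)`. -/
def matNorm {d : ℕ} (M : Matrix (Fin d ⊕ Fin d) (Fin d ⊕ Fin d) ℝ) (v : Param d) : ℝ :=
  √(WithLp.ofLp v ⬝ᵥ (M *ᵥ WithLp.ofLp v))

/-- `α(M) = 2 √λ θ̄ + (2 σ̄ / g̲) √(2 log T + log(det M / λ^(2d)))`. -/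
def confRadius {d : ℕ} (lam θbar σ glow : ℝ) (T : ℕ)
    (M : Matrix (Fin d ⊕ Fin d) (Fin d ⊕ Fin d) ℝ) : ℝ :=
  2 * √lam * θbar +
    2 * σ / glow * √(2 * Real.log T + Real.log (M.det / lam ^ (2 * d)))

/-- `ᾱ` for the regularization parameter `λ = 1`. -/
def alphaBar (d : ℕ) (θbar σ glow : ℝ) (T : ℕ) : ℝ :=
  2 * θbar +
    2 * σ / glow * √(2 * Real.log T + 2 * d * Real.log ((2 * d + T) / (2 * d)))

/-- The confidence set `{θ ∈ Θ : ‖θ - θ̌‖_M ≤ α(M) + √((2 / g̲) Δ)}`. -/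
def confSet {d : ℕ} (Θ : Set (Param d)) (lam θbar σ glow : ℝ) (T : ℕ)
    (M : Matrix (Fin d ⊕ Fin d) (Fin d ⊕ Fin d) ℝ) (θcheck : Param d) (Δ : ℝ) : Set (Param d) :=
  {θ ∈ Θ | matNorm M (θ - θcheck) ≤ confRadius lam θbar σ glow T M + √(2 / glow * Δ)}

/-- One trajectory of UCB pricing with approximation over the periods `1, …, T`: `x` are the
covariates, `D` the observed demands, `θhat t` the exact and `θcheck t` the approximate
quasi-MLE computed from the first `t` observations (`t = 0, …, T - 1`), `Δ t` the approximation gap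
(or an upper bound on it) that the algorithm uses, `θucb t` the optimistic parameter and `p t` the
price of period `t`. -/
structure IsApproxUCBRun {d : ℕ} (g : ℝ → ℝ) (Θ : Set (Param d))
    (pstar : Param d → Covariate d → ℝ) (lam θbar σ glow : ℝ) (T : ℕ)
    (x : ℕ → Covariate d) (D : ℕ → ℝ) (Δ : ℕ → ℝ) (θhat θcheck θucb : ℕ → Param d)
    (p : ℕ → ℝ) : Prop where
  hat_mem : ∀ t < T, θhat t ∈ Θ
  hat_max : ∀ t < T,
    IsMaxOn (quasiObjective g lam glow (fun τ => feature (x τ) (p τ)) D t) Θ (θhat t)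
  check_mem : ∀ t < T, θcheck t ∈ Θ
  gap_le : ∀ t < T,
    quasiObjective g lam glow (fun τ => feature (x τ) (p τ)) D t (θhat t) -
      quasiObjective g lam glow (fun τ => feature (x τ) (p τ)) D t (θcheck t) ≤ Δ t
  ucb_mem : ∀ t ∈ Finset.Icc 1 T, θucb t ∈ confSet Θ lam θbar σ glow T
    (designMatrix lam (fun τ => feature (x τ) (p τ)) (t - 1)) (θcheck (t - 1)) (Δ (t - 1))
  ucb_max : ∀ t ∈ Finset.Icc 1 T, IsMaxOn (fun θ => optRevenue g θ (x t))
    (confSet Θ lam θbar σ glow T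
      (designMatrix lam (fun τ => feature (x τ) (p τ)) (t - 1)) (θcheck (t - 1)) (Δ (t - 1)))
    (θucb t)
  price_eq : ∀ t ∈ Finset.Icc 1 T, p t = pstar (θucb t) (x t)

/-- `ε_1, …, ε_T` is a `σ²`-sub-Gaussian martingale difference sequence for the filtration `ℱ`. -/
structure IsSubGaussianMDS {Ω : Type*} {m : MeasurableSpace Ω} (P : Measure Ω)
    (ℱ : Filtration ℕ m) (ε : ℕ → Ω → ℝ) (σ : ℝ) (T : ℕ) : Prop where
  meas : ∀ t ∈ Finset.Icc 1 T, Measurable[ℱ t] (ε t)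
  integrable_exp : ∀ t ∈ Finset.Icc 1 T, ∀ s : ℝ,
    Integrable (fun ω => Real.exp (s * ε t ω)) P
  condExp_eq_zero : ∀ t ∈ Finset.Icc 1 T, P[ε t | ℱ (t - 1)] =ᵐ[P] 0
  condExp_exp_le : ∀ t ∈ Finset.Icc 1 T, ∀ s : ℝ,
    ∀ᵐ ω ∂P, (P[fun ω' => Real.exp (s * ε t ω') | ℱ (t - 1)]) ω ≤ Real.exp (σ ^ 2 * s ^ 2 / 2)

/-- Regret `𝔼[∑ r*(θ*, x_t)] - 𝔼[∑ r_t]`, where `r_t = p_t D_t` is the revenue obtained in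
period `t`. For a deterministic sequence of covariates the first term is `∑ r*(θ*, x_t)`. -/
def regret {d : ℕ} {Ω : Type*} {m : MeasurableSpace Ω} (P : Measure Ω) (g : ℝ → ℝ)
    (θstar : Param d) (T : ℕ) (x : ℕ → Ω → Covariate d) (p ε : ℕ → Ω → ℝ) : ℝ :=
  (∫ ω, ∑ t ∈ Finset.Icc 1 T, optRevenue g θstar (x t ω) ∂P) -
    ∫ ω, ∑ t ∈ Finset.Icc 1 T, p t ω * demand g θstar (x t ω) (p t ω) (ε t ω) ∂P

end

/-! The price is optimistic: if θ* lies in the confidence set, then r*(θ*, x_t) ≤ r*(θ_t, x_t) =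
r(p_t; θ_t, x_t), so the loss of period t is at most p̄ ḡ |z_tᵀ(θ_t − θ*)|. Cauchy–Schwarz splits
this into the width of the confidence set in the norm of M_{t−1} and the dual norm of z_t
(`IsApproxUCBRun.loss_le`). The dual norms are summed by the elliptic potential bound
(`sum_matNorm_inv_le`).

The confidence set is justified by strong concavity. The weight 1/h is chosen so that u = g(v) turns
l_τ into minus a primitive of g(v) − D_τ; over Θ it is therefore concave in z_τᵀθ with curvature at
least g̲, and the regularized objective grows quadratically in the norm of M_t away from its
maximizer. This turns the optimality gap into a distance (`matNorm_sub_le_of_gap`), and bounds the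
distance from θ* to the maximizer by the dual norm of the score S = ∑ ε_τ z_τ plus a regularization
term (`matNorm_sub_quasiMLE_le`).

The score is controlled by the method of mixtures: for normalized noise, exp(‖S‖²/2)/√(det M), with
the dual norm of S, is a nonnegative supermartingale, and Ville's inequality bounds it at all times
at once (`exists_measurable_self_normalized_bound`).

The level is T⁴, so this fails with probability at most T⁻⁴. The elliptic potential bound yields √3
where the theorem allows 2, and the difference pays for the failure event when T ≥ 2
(`mul_inv_pow_le_slack`). For T = 1 a crude bound suffices. -/

/-! ### Strong concavity of the quasi-likelihood. -/

/-- Substitution u = g(v): the Jacobian g'(v) cancels the weight 1/h(g(v)). Only points of the range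
of g occur, so the values of `Function.invFun` elsewhere play no role. -/
theorem intervalIntegral_likIntegrand_of_le {g : ℝ → ℝ} (hgmono : StrictMono g)
    (hgdiff : Differentiable ℝ g) {a b : ℝ} (hab : a ≤ b)
    (hpos : ∀ v ∈ Set.Icc a b, 0 < deriv g v) (D : ℝ) :
    ∫ u in (g a)..(g b), likIntegrand g D u = ∫ v in a..b, (g v - D) := by
  have himg : g '' Set.Icc a b = Set.Icc (g a) (g b) := by
    apply Set.Subset.antisymm
    · rintro _ ⟨v, hv, rfl⟩
      exact ⟨hgmono.monotone hv.1, hgmono.monotone hv.2⟩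
    · exact intermediate_value_Icc hab hgdiff.continuous.continuousOn
  rw [intervalIntegral.integral_of_le (hgmono.monotone hab), intervalIntegral.integral_of_le hab,
    ← integral_Icc_eq_integral_Ioc, ← integral_Icc_eq_integral_Ioc, ← himg,
    integral_image_eq_integral_abs_deriv_smul measurableSet_Icc
      (fun v _ => (hgdiff v).hasDerivAt.hasDerivWithinAt) hgmono.injective.injOn]
  refine setIntegral_congr_fun measurableSet_Icc fun v hv => ?_
  have h := hpos v hv
  simp only [likIntegrand, linkWeight, Function.leftInverse_invFun hgmono.injective v,
    smul_eq_mul, abs_of_pos h]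
  field_simp

theorem intervalIntegral_likIntegrand {g : ℝ → ℝ} (hgmono : StrictMono g)
    (hgdiff : Differentiable ℝ g) {a b : ℝ} (hpos : ∀ v ∈ Set.uIcc a b, 0 < deriv g v) (D : ℝ) :
    ∫ u in (g a)..(g b), likIntegrand g D u = ∫ v in a..b, (g v - D) := by
  rcases le_total a b with hab | hab
  · rw [Set.uIcc_of_le hab] at hpos
    exact intervalIntegral_likIntegrand_of_le hgmono hgdiff hab hpos D
  · rw [Set.uIcc_of_ge hab] at hpos
    rw [intervalIntegral.integral_symm, intervalIntegral.integral_symm (a := b),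
      intervalIntegral_likIntegrand_of_le hgmono hgdiff hab hpos D]

/-- Quadratic lower bound for the primitive of a function with slope at least `m`. -/
theorem le_intervalIntegral_sub_of_le_deriv {g : ℝ → ℝ} (hgdiff : Differentiable ℝ g) {m a b : ℝ}
    (hm : ∀ v ∈ Set.uIcc a b, m ≤ deriv g v) (D : ℝ) :
    (g a - D) * (b - a) + m / 2 * (b - a) ^ 2 ≤ ∫ v in a..b, (g v - D) := by
  have hlin : ∫ v in a..b, (g a - D + m * (v - a)) =
      (g a - D) * (b - a) + m / 2 * (b - a) ^ 2 := by
    have hc : IntervalIntegrable (fun v : ℝ => m * (v - a)) volume a b :=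
      Continuous.intervalIntegrable (by fun_prop) _ _
    rw [intervalIntegral.integral_add intervalIntegrable_const hc,
      intervalIntegral.integral_const_mul, intervalIntegral.integral_comp_sub_right (fun v => v)]
    simp
    ring
  have hi₁ : ∀ a' b' : ℝ, IntervalIntegrable (fun v => g a - D + m * (v - a)) volume a' b' :=
    fun a' b' => Continuous.intervalIntegrable (by fun_prop) _ _
  have hi₂ : ∀ a' b' : ℝ, IntervalIntegrable (fun v => g v - D) volume a' b' := fun a' b' =>
    Continuous.intervalIntegrable (hgdiff.continuous.sub continuous_const) _ _
  rw [← hlin]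
  -- The mean value inequality is stated for ordered pairs in the whole interval, so that it also
  -- serves the reversed orientation b ≤ a, where both integrals change sign.
  have key : ∀ u ∈ Set.uIcc a b, ∀ v ∈ Set.uIcc a b, u ≤ v → m * (v - u) ≤ g v - g u :=
    (convex_uIcc a b).mul_sub_le_image_sub_of_le_deriv hgdiff.continuous.continuousOn
      hgdiff.differentiableOn (fun v hv => hm v (interior_subset hv))
  rcases le_total a b with hab | hab
  · refine intervalIntegral.integral_mono_on hab (hi₁ _ _) (hi₂ _ _) fun v hv => ?_
    have := key a Set.left_mem_uIcc v (Set.Icc_subset_uIcc hv) hv.1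
    linarith
  · rw [intervalIntegral.integral_symm b a, intervalIntegral.integral_symm b a, neg_le_neg_iff]
    refine intervalIntegral.integral_mono_on hab (hi₂ _ _) (hi₁ _ _) fun v hv => ?_
    have := key v (Set.Icc_subset_uIcc' hv) a Set.left_mem_uIcc hv.2
    linarith

theorem quasiLik_le {d : ℕ} {g : ℝ → ℝ} (hgmono : StrictMono g)
    (hgdiff : Differentiable ℝ g) {m D : ℝ} (hm0 : 0 < m) {z θ₁ θ₂ : Param d}
    (hm : ∀ v ∈ Set.uIcc (inner ℝ z θ₂) (inner ℝ z θ₁), m ≤ deriv g v)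
    (h₁ : IntervalIntegrable (likIntegrand g D) volume D (g (inner ℝ z θ₁)))
    (h₂ : IntervalIntegrable (likIntegrand g D) volume D (g (inner ℝ z θ₂))) :
    quasiLik g z D θ₁ ≤ quasiLik g z D θ₂ + (D - g (inner ℝ z θ₂)) * inner ℝ z (θ₁ - θ₂)
      - m / 2 * (inner ℝ z (θ₁ - θ₂)) ^ 2 := by
  -- D may lie outside the range of g. The two integrals from D are subtracted first, and only the
  -- piece between two values of g is substituted.
  have h := intervalIntegral.integral_interval_sub_left h₁ h₂
  rw [intervalIntegral_likIntegrand hgmono hgdiff (fun v hv => hm0.trans_le (hm v hv))] at h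
  have h' := le_intervalIntegral_sub_of_le_deriv hgdiff hm D
  simp only [quasiLik, inner_sub_right]
  linarith

/-- The objective lies below its linearization, with a quadratic gap. -/
theorem quasiObjective_le {d : ℕ} {g : ℝ → ℝ} (hgmono : StrictMono g)
    (hgdiff : Differentiable ℝ g) {m : ℝ} (hm0 : 0 < m) {z : ℕ → Param d} {D : ℕ → ℝ} {t : ℕ}
    {Θ : Set (Param d)}
    (hm : ∀ τ ∈ Finset.Icc 1 t, ∀ θ₁ ∈ Θ, ∀ θ₂ ∈ Θ,
      ∀ v ∈ Set.uIcc (inner ℝ (z τ) θ₂) (inner ℝ (z τ) θ₁), m ≤ deriv g v)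
    (hint : ∀ τ ∈ Finset.Icc 1 t, ∀ θ ∈ Θ,
      IntervalIntegrable (likIntegrand g (D τ)) volume (D τ) (g (inner ℝ (z τ) θ)))
    {θ₁ θ₂ : Param d} (h₁ : θ₁ ∈ Θ) (h₂ : θ₂ ∈ Θ) :
    quasiObjective g 1 m z D t θ₁ ≤ quasiObjective g 1 m z D t θ₂
      + (∑ τ ∈ Finset.Icc 1 t, (D τ - g (inner ℝ (z τ) θ₂)) * inner ℝ (z τ) (θ₁ - θ₂)
          - 2 * m * inner ℝ θ₂ (θ₁ - θ₂))
      - m / 2 * (‖θ₁ - θ₂‖ ^ 2 + ∑ τ ∈ Finset.Icc 1 t, (inner ℝ (z τ) (θ₁ - θ₂)) ^ 2) := by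
  have hsum := Finset.sum_le_sum fun τ hτ => quasiLik_le hgmono hgdiff hm0
    (hm τ hτ θ₁ h₁ θ₂ h₂) (hint τ hτ θ₁ h₁) (hint τ hτ θ₂ h₂)
  rw [Finset.sum_sub_distrib, Finset.sum_add_distrib, ← Finset.mul_sum] at hsum
  have hn : ‖θ₁‖ ^ 2 = ‖θ₂‖ ^ 2 + 2 * inner ℝ θ₂ (θ₁ - θ₂) + ‖θ₁ - θ₂‖ ^ 2 := by
    rw [← norm_add_sq_real, add_sub_cancel]
  simp only [quasiObjective, hn]
  -- The regularizer contributes a gap m‖θ₁ - θ₂‖²; half of it is dropped so that the total is m/2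
  -- times the squared norm of the design matrix.
  nlinarith [mul_nonneg hm0.le (sq_nonneg ‖θ₁ - θ₂‖)]

/-- Quadratic growth of the objective away from its maximizer over a convex set. -/
theorem quasiObjective_growth {d : ℕ} {g : ℝ → ℝ} (hgmono : StrictMono g)
    (hgdiff : Differentiable ℝ g) {m : ℝ} (hm0 : 0 < m) {z : ℕ → Param d} {D : ℕ → ℝ} {t : ℕ}
    {Θ : Set (Param d)} (hΘ : Convex ℝ Θ)
    (hm : ∀ τ ∈ Finset.Icc 1 t, ∀ θ₁ ∈ Θ, ∀ θ₂ ∈ Θ,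
      ∀ v ∈ Set.uIcc (inner ℝ (z τ) θ₂) (inner ℝ (z τ) θ₁), m ≤ deriv g v)
    (hint : ∀ τ ∈ Finset.Icc 1 t, ∀ θ ∈ Θ,
      IntervalIntegrable (likIntegrand g (D τ)) volume (D τ) (g (inner ℝ (z τ) θ)))
    {θhat θ : Param d} (hhat : θhat ∈ Θ) (hmax : IsMaxOn (quasiObjective g 1 m z D t) Θ θhat)
    (hθ : θ ∈ Θ) :
    m / 2 * (‖θ - θhat‖ ^ 2 + ∑ τ ∈ Finset.Icc 1 t, (inner ℝ (z τ) (θ - θhat)) ^ 2) ≤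
      quasiObjective g 1 m z D t θhat - quasiObjective g 1 m z D t θ := by
  set N := ‖θ - θhat‖ ^ 2 + ∑ τ ∈ Finset.Icc 1 t, (inner ℝ (z τ) (θ - θhat)) ^ 2 with hN
  set L := quasiObjective g 1 m z D t with hL
  -- No first-order condition at `θhat` is needed: both endpoints are compared with the
  -- linearization at an intermediate point c. With weights 1 - s and s the linear terms cancel, the
  -- quadratic ones add up to s(1 - s)N, and L c ≤ L θhat. Dividing by s and letting s → 0 gives the
  -- claim.
  have key : ∀ s ∈ Set.Ioo (0 : ℝ) 1, m / 2 * (1 - s) * N ≤ L θhat - L θ := by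
    intro s hs
    have hc : θhat + s • (θ - θhat) ∈ Θ :=
      hΘ.add_smul_sub_mem hhat hθ ⟨hs.1.le, hs.2.le⟩
    set c := θhat + s • (θ - θhat) with hcdef
    have e₁ : θhat - c = (-s) • (θ - θhat) := by rw [hcdef]; module
    have e₂ : θ - c = (1 - s) • (θ - θhat) := by rw [hcdef]; module
    have i₁ := quasiObjective_le hgmono hgdiff hm0 hm hint hhat hc
    have i₂ := quasiObjective_le hgmono hgdiff hm0 hm hint hθ hc
    have quad : ∀ r : ℝ, ‖r • (θ - θhat)‖ ^ 2 +
        ∑ τ ∈ Finset.Icc 1 t, (inner ℝ (z τ) (r • (θ - θhat))) ^ 2 = r ^ 2 * N := by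
      intro r
      simp only [norm_smul, mul_pow, inner_smul_right, ← Finset.mul_sum, Real.norm_eq_abs, sq_abs,
        hN]
      ring
    have lin : ∀ r : ℝ, ∑ τ ∈ Finset.Icc 1 t,
        (D τ - g (inner ℝ (z τ) c)) * inner ℝ (z τ) (r • (θ - θhat)) -
          2 * m * inner ℝ c (r • (θ - θhat)) =
        r * (∑ τ ∈ Finset.Icc 1 t, (D τ - g (inner ℝ (z τ) c)) * inner ℝ (z τ) (θ - θhat) -
          2 * m * inner ℝ c (θ - θhat)) := by
      intro r
      simp only [inner_smul_right]
      rw [mul_sub, Finset.mul_sum]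
      congr 1
      · exact Finset.sum_congr rfl fun τ _ => by ring
      · ring
    rw [e₁, quad, lin] at i₁
    rw [e₂, quad, lin] at i₂
    have i₃ : L c ≤ L θhat := hmax hc
    rw [← hL] at i₁ i₂
    have j₁ := mul_le_mul_of_nonneg_left i₁ (sub_nonneg.2 hs.2.le)
    have j₂ := mul_le_mul_of_nonneg_left i₂ hs.1.le
    have : s * (m / 2 * (1 - s) * N) ≤ s * (L θhat - L θ) := by
      nlinarith [j₁, j₂, i₃]
    exact le_of_mul_le_mul_left this hs.1
  have hlim : Filter.Tendsto (fun s : ℝ => m / 2 * (1 - s) * N) (nhdsWithin 0 (Set.Ioi 0))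
      (nhds (m / 2 * (1 - 0) * N)) :=
    (Continuous.tendsto (by fun_prop) 0).mono_left nhdsWithin_le_nhds
  rw [sub_zero, mul_one] at hlim
  exact le_of_tendsto hlim
    (Filter.eventually_of_mem (Ioo_mem_nhdsGT one_pos) fun s hs => key s hs)

/-- The estimation error of the quasi-MLE is controlled by the score at the true parameter. -/
theorem quasiMLE_error_le {d : ℕ} {g : ℝ → ℝ} (hgmono : StrictMono g)
    (hgdiff : Differentiable ℝ g) {m : ℝ} (hm0 : 0 < m) {z : ℕ → Param d} {D : ℕ → ℝ} {t : ℕ}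
    {Θ : Set (Param d)} (hΘ : Convex ℝ Θ)
    (hm : ∀ τ ∈ Finset.Icc 1 t, ∀ θ₁ ∈ Θ, ∀ θ₂ ∈ Θ,
      ∀ v ∈ Set.uIcc (inner ℝ (z τ) θ₂) (inner ℝ (z τ) θ₁), m ≤ deriv g v)
    (hint : ∀ τ ∈ Finset.Icc 1 t, ∀ θ ∈ Θ,
      IntervalIntegrable (likIntegrand g (D τ)) volume (D τ) (g (inner ℝ (z τ) θ)))
    {θhat θ : Param d} (hhat : θhat ∈ Θ) (hmax : IsMaxOn (quasiObjective g 1 m z D t) Θ θhat)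
    (hθ : θ ∈ Θ) :
    m * (‖θ - θhat‖ ^ 2 + ∑ τ ∈ Finset.Icc 1 t, (inner ℝ (z τ) (θ - θhat)) ^ 2) ≤
      inner ℝ (∑ τ ∈ Finset.Icc 1 t, (D τ - g (inner ℝ (z τ) θ)) • z τ) (θhat - θ) +
        2 * m * ‖θ‖ * ‖θ - θhat‖ := by
  have i₁ := quasiObjective_growth hgmono hgdiff hm0 hΘ hm hint hhat hmax hθ
  have i₂ := quasiObjective_le hgmono hgdiff hm0 hm hint hhat hθ
  have e₁ : ‖θhat - θ‖ = ‖θ - θhat‖ := norm_sub_rev _ _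
  have e₂ : ∀ τ, (inner ℝ (z τ) (θhat - θ)) ^ 2 = (inner ℝ (z τ) (θ - θhat)) ^ 2 := by
    intro τ
    rw [← neg_sub θ θhat, inner_neg_right, neg_sq]
  simp only [e₁, e₂] at i₂
  have i₃ : -inner ℝ θ (θhat - θ) ≤ ‖θ‖ * ‖θ - θhat‖ := by
    rw [← e₁]
    exact (neg_le_abs _).trans (abs_real_inner_le_norm _ _)
  simp only [sum_inner, inner_smul_left, conj_trivial]
  -- Growth at `θhat` and the linearization at `θ` each supply half of the quadratic term, and the
  -- objective values cancel.
  nlinarith [mul_le_mul_of_nonneg_left i₃ hm0.le]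

/-! ### Positive definite matrices: Cauchy–Schwarz, rank-one updates, determinant and trace. -/

section MatrixFacts

variable {n : Type*} [Fintype n]

theorem Matrix.PosDef.dotProduct_mulVec_nonneg_real {M : Matrix n n ℝ} (hM : M.PosDef)
    (v : n → ℝ) : 0 ≤ v ⬝ᵥ (M *ᵥ v) := by
  simpa using hM.posSemidef.dotProduct_mulVec_nonneg v

theorem Matrix.PosDef.dotProduct_mulVec_comm_real {M : Matrix n n ℝ} (hM : M.PosDef)
    (u v : n → ℝ) : u ⬝ᵥ (M *ᵥ v) = v ⬝ᵥ (M *ᵥ u) := by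
  have h : Mᵀ = M := by simpa using hM.isHermitian.eq
  rw [Matrix.dotProduct_mulVec, ← Matrix.mulVec_transpose, h, dotProduct_comm]

/-- Cauchy–Schwarz for the inner product of a positive definite matrix. -/
theorem Matrix.PosDef.sq_dotProduct_mulVec_le {M : Matrix n n ℝ} (hM : M.PosDef) (u v : n → ℝ) :
    (u ⬝ᵥ (M *ᵥ v)) ^ 2 ≤ (u ⬝ᵥ (M *ᵥ u)) * (v ⬝ᵥ (M *ᵥ v)) := by
  -- The quadratic s ↦ ‖u + s v‖² in the norm of M is nonnegative, so its discriminant is not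
  -- positive.
  have h := discrim_le_zero (a := v ⬝ᵥ (M *ᵥ v)) (b := 2 * (u ⬝ᵥ (M *ᵥ v)))
    (c := u ⬝ᵥ (M *ᵥ u)) fun s => by
      have h0 := hM.dotProduct_mulVec_nonneg_real (u + s • v)
      simp only [Matrix.mulVec_add, Matrix.mulVec_smul, dotProduct_add, add_dotProduct,
        dotProduct_smul, smul_dotProduct, smul_eq_mul, hM.dotProduct_mulVec_comm_real v u] at h0
      linarith
  rw [discrim] at h
  linarith

theorem Matrix.PosDef.add_vecMulVec {M : Matrix n n ℝ} (hM : M.PosDef) (z : n → ℝ) :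
    (M + Matrix.vecMulVec z z).PosDef :=
  hM.add_posSemidef (by simpa using Matrix.posSemidef_vecMulVec_self_star z)

variable [DecidableEq n]

theorem Matrix.PosDef.isUnit_det_real {M : Matrix n n ℝ} (hM : M.PosDef) : IsUnit M.det :=
  hM.det_pos.ne'.isUnit

/-- Cauchy–Schwarz for the dual norms of a positive definite matrix. -/
theorem Matrix.PosDef.sq_dotProduct_le {M : Matrix n n ℝ} (hM : M.PosDef) (u v : n → ℝ) :
    (u ⬝ᵥ v) ^ 2 ≤ (u ⬝ᵥ (M⁻¹ *ᵥ u)) * (v ⬝ᵥ (M *ᵥ v)) := by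
  have h := hM.sq_dotProduct_mulVec_le (M⁻¹ *ᵥ u) v
  have e : M *ᵥ (M⁻¹ *ᵥ u) = u := by
    rw [Matrix.mulVec_mulVec, Matrix.mul_nonsing_inv _ hM.isUnit_det_real, Matrix.one_mulVec]
  rw [hM.dotProduct_mulVec_comm_real, e] at h
  rwa [dotProduct_comm v u, dotProduct_comm _ u] at h

/-- Matrix determinant lemma. -/
theorem Matrix.PosDef.det_add_vecMulVec {M : Matrix n n ℝ} (hM : M.PosDef) (z : n → ℝ) :
    (M + Matrix.vecMulVec z z).det = M.det * (1 + z ⬝ᵥ (M⁻¹ *ᵥ z)) := by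
  rw [Matrix.vecMulVec_eq Unit, Matrix.det_add_replicateCol_mul_replicateRow hM.isUnit_det_real]
  congr 1
  rw [Matrix.det_unique, Matrix.add_apply, Matrix.one_apply_eq, Matrix.mul_assoc,
    ← Matrix.replicateCol_mulVec, Matrix.replicateRow_mul_replicateCol_apply]

/-- Sherman–Morrison formula, for a vector updated along the same direction. -/
theorem Matrix.PosDef.dotProduct_inv_add_vecMulVec {M : Matrix n n ℝ} (hM : M.PosDef)
    (z s : n → ℝ) (e : ℝ) :
    (s + e • z) ⬝ᵥ ((M + Matrix.vecMulVec z z)⁻¹ *ᵥ (s + e • z)) =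
      s ⬝ᵥ (M⁻¹ *ᵥ s) + (2 * e * (z ⬝ᵥ (M⁻¹ *ᵥ s)) + e ^ 2 * (z ⬝ᵥ (M⁻¹ *ᵥ z)) -
        (z ⬝ᵥ (M⁻¹ *ᵥ s)) ^ 2) / (1 + z ⬝ᵥ (M⁻¹ *ᵥ z)) := by
  have hw : 0 ≤ z ⬝ᵥ (M⁻¹ *ᵥ z) := hM.inv.dotProduct_mulVec_nonneg_real z
  set w := z ⬝ᵥ (M⁻¹ *ᵥ z) with hwdef
  set a := z ⬝ᵥ (M⁻¹ *ᵥ s) with hadef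
  have hw' : 1 + w ≠ 0 := by positivity
  -- The Sherman–Morrison candidate for the solution of (M + z zᵀ) y = s + e z, verified by
  -- multiplication.
  set y := M⁻¹ *ᵥ s + ((e - a) / (1 + w)) • (M⁻¹ *ᵥ z) with hy
  have hMi : ∀ v, M *ᵥ (M⁻¹ *ᵥ v) = v := fun v => by
    rw [Matrix.mulVec_mulVec, Matrix.mul_nonsing_inv _ hM.isUnit_det_real, Matrix.one_mulVec]
  have h1 : (M + Matrix.vecMulVec z z) *ᵥ y = s + e • z := by
    rw [Matrix.add_mulVec, Matrix.vecMulVec_mulVec, hy]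
    simp only [Matrix.mulVec_add, Matrix.mulVec_smul, hMi, dotProduct_add, dotProduct_smul,
      ← hwdef, ← hadef, smul_eq_mul]
    ext i
    simp
    field_simp
    ring
  have h2 : (M + Matrix.vecMulVec z z)⁻¹ *ᵥ (s + e • z) = y := by
    rw [← h1, Matrix.mulVec_mulVec,
      Matrix.nonsing_inv_mul _ (hM.add_vecMulVec z).isUnit_det_real, Matrix.one_mulVec]
  rw [h2, hy]
  simp only [dotProduct_add, add_dotProduct, dotProduct_smul, smul_dotProduct, smul_eq_mul,
    hM.inv.dotProduct_mulVec_comm_real s z, ← hwdef, ← hadef]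
  field_simp
  ring

/-- Determinant–trace inequality. -/
theorem Matrix.PosDef.log_det_le [Nonempty n] {M : Matrix n n ℝ} (hM : M.PosDef) :
    Real.log M.det ≤ Fintype.card n * Real.log (M.trace / Fintype.card n) := by
  have hN : (0 : ℝ) < Fintype.card n := by exact_mod_cast Fintype.card_pos
  have hpos := hM.eigenvalues_pos
  -- Arithmetic–geometric mean inequality for the eigenvalues.
  have h := Real.geom_mean_le_arith_mean_weighted Finset.univ
    (fun _ : n => (Fintype.card n : ℝ)⁻¹) hM.isHermitian.eigenvalues
    (fun _ _ => by positivity) (by simp [hN.ne']) (fun i _ => (hpos i).le)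
  rw [← Finset.mul_sum, Real.finsetProd_rpow _ _ (fun i _ => (hpos i).le)] at h
  have hd : M.det = ∏ i, hM.isHermitian.eigenvalues i := by
    simpa using hM.isHermitian.det_eq_prod_eigenvalues
  have ht : M.trace = ∑ i, hM.isHermitian.eigenvalues i := by
    simpa using hM.isHermitian.trace_eq_sum_eigenvalues
  rw [← hd, ← ht] at h
  have h' := Real.log_le_log (Real.rpow_pos_of_pos hM.det_pos _) h
  rw [Real.log_rpow hM.det_pos] at h'
  rw [div_eq_inv_mul]
  calc Real.log M.det = Fintype.card n * ((Fintype.card n : ℝ)⁻¹ * Real.log M.det) := by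
        field_simp
    _ ≤ _ := by gcongr

end MatrixFacts

/-! ### The design matrix, its norms and the elliptic potential. -/

section DesignMatrix

variable {d : ℕ}

theorem matNorm_nonneg (M : Matrix (Fin d ⊕ Fin d) (Fin d ⊕ Fin d) ℝ) (v : Param d) :
    0 ≤ matNorm M v := Real.sqrt_nonneg _

theorem sq_matNorm {M : Matrix (Fin d ⊕ Fin d) (Fin d ⊕ Fin d) ℝ} (hM : M.PosDef) (v : Param d) :
    matNorm M v ^ 2 = WithLp.ofLp v ⬝ᵥ (M *ᵥ WithLp.ofLp v) :=
  Real.sq_sqrt (hM.dotProduct_mulVec_nonneg_real _)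

theorem inner_eq_dotProduct_ofLp (u v : Param d) :
    inner ℝ u v = WithLp.ofLp u ⬝ᵥ WithLp.ofLp v := by
  rw [EuclideanSpace.inner_eq_star_dotProduct, dotProduct_comm]
  simp

theorem abs_inner_le_matNorm_inv_mul {M : Matrix (Fin d ⊕ Fin d) (Fin d ⊕ Fin d) ℝ}
    (hM : M.PosDef) (u v : Param d) : |inner ℝ u v| ≤ matNorm M⁻¹ u * matNorm M v := by
  refine abs_le_of_sq_le_sq ?_ (mul_nonneg (matNorm_nonneg _ _) (matNorm_nonneg _ _))
  rw [mul_pow, sq_matNorm hM, sq_matNorm hM.inv, inner_eq_dotProduct_ofLp]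
  exact hM.sq_dotProduct_le _ _

theorem matNorm_add_le {M : Matrix (Fin d ⊕ Fin d) (Fin d ⊕ Fin d) ℝ}
    (hM : M.PosDef) (u v : Param d) : matNorm M (u + v) ≤ matNorm M u + matNorm M v := by
  refine le_of_sq_le_sq ?_ (add_nonneg (matNorm_nonneg _ _) (matNorm_nonneg _ _))
  have h := hM.sq_dotProduct_mulVec_le (WithLp.ofLp u) (WithLp.ofLp v)
  rw [← sq_matNorm hM, ← sq_matNorm hM, ← mul_pow] at h
  have h' := (abs_le_of_sq_le_sq h (mul_nonneg (matNorm_nonneg _ _) (matNorm_nonneg _ _)))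
  have h'' := (le_abs_self _).trans h'
  rw [add_sq, sq_matNorm hM (u + v), sq_matNorm hM u, sq_matNorm hM v]
  simp only [WithLp.ofLp_add, Matrix.mulVec_add, dotProduct_add, add_dotProduct,
    hM.dotProduct_mulVec_comm_real (WithLp.ofLp v) (WithLp.ofLp u)]
  linarith

theorem matNorm_sub_rev (M : Matrix (Fin d ⊕ Fin d) (Fin d ⊕ Fin d) ℝ) (u v : Param d) :
    matNorm M (u - v) = matNorm M (v - u) := by
  rw [← neg_sub v u]
  simp only [matNorm, WithLp.ofLp_neg, Matrix.mulVec_neg, dotProduct_neg, neg_dotProduct, neg_neg]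

theorem designMatrix_zero (z : ℕ → Param d) : designMatrix 1 z 0 = 1 := by
  simp [designMatrix]

theorem designMatrix_succ (z : ℕ → Param d) (t : ℕ) :
    designMatrix 1 z (t + 1) = designMatrix 1 z t +
      Matrix.vecMulVec (WithLp.ofLp (z (t + 1))) (WithLp.ofLp (z (t + 1))) := by
  rw [designMatrix, Finset.sum_Icc_succ_top (by omega), ← add_assoc]
  rfl

theorem designMatrix_posDef (z : ℕ → Param d) (t : ℕ) : (designMatrix 1 z t).PosDef := by
  induction t with
  | zero => rw [designMatrix_zero]; exact Matrix.PosDef.one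
  | succ t ih => rw [designMatrix_succ]; exact ih.add_vecMulVec _

theorem sq_matNorm_designMatrix (z : ℕ → Param d) (t : ℕ) (v : Param d) :
    matNorm (designMatrix 1 z t) v ^ 2 =
      ‖v‖ ^ 2 + ∑ τ ∈ Finset.Icc 1 t, (inner ℝ (z τ) v) ^ 2 := by
  rw [sq_matNorm (designMatrix_posDef z t)]
  induction t with
  | zero =>
    rw [designMatrix_zero, Matrix.one_mulVec, ← inner_eq_dotProduct_ofLp, real_inner_self_eq_norm_sq]
    simp
  | succ t ih =>
    rw [designMatrix_succ, Matrix.add_mulVec, dotProduct_add, ih,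
      Finset.sum_Icc_succ_top (by omega), Matrix.vecMulVec_mulVec]
    simp only [inner_eq_dotProduct_ofLp, op_smul_eq_smul, smul_dotProduct, smul_eq_mul,
      dotProduct_comm (WithLp.ofLp v)]
    ring

theorem norm_le_matNorm_designMatrix (z : ℕ → Param d) (t : ℕ) (v : Param d) :
    ‖v‖ ≤ matNorm (designMatrix 1 z t) v := by
  refine le_of_sq_le_sq ?_ (matNorm_nonneg _ _)
  rw [sq_matNorm_designMatrix]
  exact le_add_of_nonneg_right (Finset.sum_nonneg fun _ _ => sq_nonneg _)

/-- M ≥ I implies M⁻¹ ≤ I. With u = M⁻¹v, the squared dual norm of v is ⟨v, u⟩ ≤ ‖v‖ ‖u‖, and ‖u‖ is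
at most the M-norm of u, which equals the dual norm of v. -/
theorem matNorm_inv_designMatrix_le (z : ℕ → Param d) (t : ℕ) (v : Param d) :
    matNorm (designMatrix 1 z t)⁻¹ v ≤ ‖v‖ := by
  set M := designMatrix 1 z t with hM
  have hP : M.PosDef := designMatrix_posDef z t
  set u : Param d := WithLp.toLp 2 (M⁻¹ *ᵥ WithLp.ofLp v) with hu
  have h1 : matNorm M u = matNorm M⁻¹ v := by
    simp only [matNorm, hu]
    rw [Matrix.mulVec_mulVec, Matrix.mul_nonsing_inv _ hP.isUnit_det_real, Matrix.one_mulVec,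
      dotProduct_comm]
  have h2 : matNorm M⁻¹ v ^ 2 = inner ℝ v u := by
    rw [sq_matNorm hP.inv, inner_eq_dotProduct_ofLp]
  have h3 : inner ℝ v u ≤ ‖v‖ * ‖u‖ := real_inner_le_norm v u
  have h4 : ‖u‖ ≤ matNorm M⁻¹ v := h1 ▸ norm_le_matNorm_designMatrix z t u
  have h5 : matNorm M⁻¹ v * matNorm M⁻¹ v ≤ ‖v‖ * matNorm M⁻¹ v := by
    rw [← sq, h2]
    exact h3.trans (by gcongr)
  rcases (matNorm_nonneg M⁻¹ v).eq_or_lt with h | h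
  · rw [← h]; exact norm_nonneg v
  · exact le_of_mul_le_mul_right h5 h

theorem trace_designMatrix (z : ℕ → Param d) (t : ℕ) :
    (designMatrix 1 z t).trace = 2 * d + ∑ τ ∈ Finset.Icc 1 t, ‖z τ‖ ^ 2 := by
  simp only [designMatrix, one_smul, Matrix.trace_add, Matrix.trace_sum, Matrix.trace_one,
    Matrix.trace_vecMulVec, ← inner_eq_dotProduct_ofLp, real_inner_self_eq_norm_sq,
    Fintype.card_sum, Fintype.card_fin]
  push_cast
  ring

theorem log_det_designMatrix_le (hd : 1 ≤ d) {z : ℕ → Param d} {t T : ℕ} (htT : t ≤ T)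
    (hz : ∀ τ ∈ Finset.Icc 1 t, ‖z τ‖ ≤ 1) :
    Real.log (designMatrix 1 z t).det ≤ 2 * d * Real.log ((2 * d + T) / (2 * d)) := by
  have : Nonempty (Fin d ⊕ Fin d) := ⟨Sum.inl ⟨0, hd⟩⟩
  have hd' : (1 : ℝ) ≤ d := by exact_mod_cast hd
  have h := (designMatrix_posDef z t).log_det_le
  have hc : ((Fintype.card (Fin d ⊕ Fin d) : ℕ) : ℝ) = 2 * d := by
    simp only [Fintype.card_sum, Fintype.card_fin]
    push_cast
    ring
  rw [hc, trace_designMatrix] at h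
  refine h.trans ?_
  have hs0 : 0 ≤ ∑ τ ∈ Finset.Icc 1 t, ‖z τ‖ ^ 2 := Finset.sum_nonneg fun _ _ => sq_nonneg _
  have hs : ∑ τ ∈ Finset.Icc 1 t, ‖z τ‖ ^ 2 ≤ T := by
    calc ∑ τ ∈ Finset.Icc 1 t, ‖z τ‖ ^ 2 ≤ ∑ τ ∈ Finset.Icc 1 t, (1 : ℝ) :=
          Finset.sum_le_sum fun τ hτ => pow_le_one₀ (norm_nonneg _) (hz τ hτ)
      _ = t := by simp
      _ ≤ T := by exact_mod_cast htT
  gcongr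

theorem log_det_designMatrix_succ (z : ℕ → Param d) (t : ℕ) :
    Real.log (designMatrix 1 z (t + 1)).det = Real.log (designMatrix 1 z t).det +
      Real.log (1 + matNorm (designMatrix 1 z t)⁻¹ (z (t + 1)) ^ 2) := by
  have hP := designMatrix_posDef z t
  rw [designMatrix_succ, hP.det_add_vecMulVec, sq_matNorm hP.inv, Real.log_mul hP.det_pos.ne']
  rw [← sq_matNorm hP.inv]
  positivity

theorem log_det_designMatrix_nonneg (z : ℕ → Param d) (t : ℕ) :
    0 ≤ Real.log (designMatrix 1 z t).det := by
  induction t with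
  | zero => simp [designMatrix_zero]
  | succ t ih =>
    rw [log_det_designMatrix_succ]
    exact add_nonneg ih (Real.log_nonneg (le_add_of_nonneg_right (sq_nonneg _)))

/-- Elliptic potential lemma. -/
theorem sum_sq_matNorm_inv_le {z : ℕ → Param d} {T : ℕ}
    (hz : ∀ τ ∈ Finset.Icc 1 T, ‖z τ‖ ≤ 1) :
    ∑ t ∈ Finset.Icc 1 T, matNorm (designMatrix 1 z (t - 1))⁻¹ (z t) ^ 2 ≤
      3 / 2 * Real.log (designMatrix 1 z T).det := by
  induction T with
  | zero => simp [designMatrix_zero]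
  | succ T ih =>
    have ih' := ih fun τ hτ => hz τ (by simp only [Finset.mem_Icc] at hτ ⊢; omega)
    rw [Finset.sum_Icc_succ_top (by omega), log_det_designMatrix_succ, mul_add,
      Nat.add_sub_cancel]
    refine add_le_add ih' ?_
    set w := matNorm (designMatrix 1 z T)⁻¹ (z (T + 1)) ^ 2 with hw
    have hw0 : 0 ≤ w := sq_nonneg _
    have hw1 : w ≤ 1 := pow_le_one₀ (matNorm_nonneg _ _)
      ((matNorm_inv_designMatrix_le z T _).trans (hz (T + 1) (by simp)))
    -- log(1 + w) ≥ 2w/(w + 2) ≥ 2w/3 because w ≤ 1. This is the source of 3/2, hence of √3 in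
    -- `sum_matNorm_inv_le`.
    have h := Real.le_log_one_add_of_nonneg hw0
    rw [div_le_iff₀ (by positivity)] at h
    have hl : 0 ≤ Real.log (1 + w) := Real.log_nonneg (by linarith)
    nlinarith

theorem sum_matNorm_inv_le (hd : 1 ≤ d) {z : ℕ → Param d} {T : ℕ}
    (hz : ∀ τ ∈ Finset.Icc 1 T, ‖z τ‖ ≤ 1) :
    ∑ t ∈ Finset.Icc 1 T, matNorm (designMatrix 1 z (t - 1))⁻¹ (z t) ≤
      √3 * √(T * d * Real.log ((2 * d + T) / (2 * d))) := by
  rw [← Real.sqrt_mul (by norm_num)]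
  refine Real.le_sqrt_of_sq_le ?_
  have h1 := sq_sum_le_card_mul_sum_sq (s := Finset.Icc 1 T)
    (f := fun t => matNorm (designMatrix 1 z (t - 1))⁻¹ (z t))
  have h2 := sum_sq_matNorm_inv_le hz
  have h3 := log_det_designMatrix_le hd le_rfl hz
  rw [Nat.card_Icc, Nat.add_sub_cancel] at h1
  refine h1.trans ?_
  have hT : (0 : ℝ) ≤ T := Nat.cast_nonneg T
  nlinarith [mul_le_mul_of_nonneg_left h2 hT, mul_le_mul_of_nonneg_left h3 hT]

end DesignMatrix

/-! ### A one-dimensional Gaussian integral. -/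

section GaussianMixture

/-- Completing the square under a standard Gaussian. -/
theorem lintegral_exp_gaussianReal {a w : ℝ} (hw : 0 ≤ w) (e : ℝ) :
    ∫⁻ ξ, ENNReal.ofReal (Real.exp ((a + √w * ξ) * e - (a + √w * ξ) ^ 2 / 2))
        ∂(ProbabilityTheory.gaussianReal 0 1) =
      ENNReal.ofReal
        (Real.exp ((2 * e * a + e ^ 2 * w - a ^ 2) / (1 + w) / 2) / √(1 + w)) := by
  have hw1 : 0 < 1 + w := by linarith
  -- Variance of the exponentially tilted Gaussian. Its density times the constant K below is the
  -- integrand, so the integral is K.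
  set v : NNReal := ⟨(1 + w)⁻¹, by positivity⟩ with hv
  have hv0 : v ≠ 0 := by
    intro h
    have : (1 + w)⁻¹ = 0 := congrArg NNReal.toReal h
    exact hw1.ne' (inv_eq_zero.1 this)
  set K := Real.exp ((2 * e * a + e ^ 2 * w - a ^ 2) / (1 + w) / 2) / √(1 + w) with hK
  have hpt : ∀ ξ, ProbabilityTheory.gaussianPDF 0 1 ξ *
      ENNReal.ofReal (Real.exp ((a + √w * ξ) * e - (a + √w * ξ) ^ 2 / 2)) =
      ENNReal.ofReal K * ProbabilityTheory.gaussianPDF (√w * (e - a) / (1 + w)) v ξ := by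
    intro ξ
    rw [ProbabilityTheory.gaussianPDF, ProbabilityTheory.gaussianPDF,
      ← ENNReal.ofReal_mul (ProbabilityTheory.gaussianPDFReal_nonneg _ _ _),
      ← ENNReal.ofReal_mul (by positivity)]
    congr 1
    have hvr : (v : ℝ) = (1 + w)⁻¹ := rfl
    rw [ProbabilityTheory.gaussianPDFReal, ProbabilityTheory.gaussianPDFReal, hK, hvr,
      NNReal.coe_one, Real.sqrt_mul (by positivity) (1 + w)⁻¹, Real.sqrt_inv, mul_one, mul_one]
    have hs : √(1 + w) ≠ 0 := (Real.sqrt_pos.2 hw1).ne'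
    rw [mul_assoc, ← Real.exp_add]
    have : (√(2 * Real.pi) * (√(1 + w))⁻¹)⁻¹ = (√(2 * Real.pi))⁻¹ * √(1 + w) := by
      rw [mul_inv, inv_inv]
    rw [this, div_mul_eq_mul_div, eq_div_iff hs]
    have hexp : -(ξ - 0) ^ 2 / 2 + ((a + √w * ξ) * e - (a + √w * ξ) ^ 2 / 2) =
        (2 * e * a + e ^ 2 * w - a ^ 2) / (1 + w) / 2 +
          -(ξ - √w * (e - a) / (1 + w)) ^ 2 / (2 * (1 + w)⁻¹) := by
      have hsq : √w ^ 2 = w := Real.sq_sqrt hw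
      field_simp
      ring_nf
      simp only [hsq]
      ring
    rw [hexp, Real.exp_add]
    ring
  rw [ProbabilityTheory.gaussianReal_of_var_ne_zero _ one_ne_zero,
    lintegral_withDensity_eq_lintegral_mul _ (ProbabilityTheory.measurable_gaussianPDF _ _)
      (by fun_prop)]
  simp only [Pi.mul_apply, hpt]
  rw [lintegral_const_mul _ (ProbabilityTheory.measurable_gaussianPDF _ _),
    ProbabilityTheory.lintegral_gaussianPDF_eq_one _ hv0, mul_one]

end GaussianMixture

/-! ### Conditional exponential bounds with predictable exponents. -/

section ConditionalSubGaussian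

variable {Ω : Type*} {m₀ m : MeasurableSpace Ω} {P : Measure[m] Ω} [IsProbabilityMeasure P]

theorem lintegral_mul_exp_le_of_condExp_exp_le (hm : m₀ ≤ m) {e : Ω → ℝ} (he : Measurable[m] e)
    {s : ℝ} (hint : Integrable (fun ω => Real.exp (s * e ω)) P)
    (hle : ∀ᵐ ω ∂P, (P[fun ω' => Real.exp (s * e ω') | m₀]) ω ≤ Real.exp (s ^ 2 / 2))
    {Y : Ω → ENNReal} (hY : Measurable[m₀] Y) :
    ∫⁻ ω, Y ω * ENNReal.ofReal (Real.exp (s * e ω - s ^ 2 / 2)) ∂P ≤ ∫⁻ ω, Y ω ∂P := by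
  have hf : Measurable[m] fun ω => ENNReal.ofReal (Real.exp (s * e ω - s ^ 2 / 2)) := by
    fun_prop
  have hint' : Integrable (fun ω => Real.exp (s * e ω - s ^ 2 / 2)) P := by
    simp only [Real.exp_sub]
    exact hint.div_const _
  -- The conditional bound says that the measure with this density is dominated by P on the smaller
  -- σ-algebra; nonnegative functions measurable there may then be integrated.
  have hμ : (P.withDensity fun ω => ENNReal.ofReal (Real.exp (s * e ω - s ^ 2 / 2))).trim hm ≤
      P.trim hm := by
    refine Measure.le_iff.2 fun A hA => ?_
    rw [trim_measurableSet_eq hm hA, trim_measurableSet_eq hm hA, withDensity_apply _ (hm A hA),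
      ← ofReal_integral_eq_lintegral_ofReal hint'.integrableOn
        (Filter.Eventually.of_forall fun _ => (Real.exp_pos _).le)]
    have h1 : ∫ ω in A, Real.exp (s * e ω) ∂P ≤ Real.exp (s ^ 2 / 2) * P.real A := by
      rw [← setIntegral_condExp hm hint hA]
      calc ∫ ω in A, (P[fun ω' => Real.exp (s * e ω') | m₀]) ω ∂P
          ≤ ∫ ω in A, Real.exp (s ^ 2 / 2) ∂P :=
            integral_mono_ae integrable_condExp.integrableOn (integrable_const _)
              (ae_restrict_of_ae hle)
        _ = _ := by rw [setIntegral_const, smul_eq_mul, mul_comm]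
    have h2 : ∫ ω in A, Real.exp (s * e ω - s ^ 2 / 2) ∂P ≤ P.real A := by
      simp only [Real.exp_sub, integral_div]
      rw [div_le_iff₀ (Real.exp_pos _), mul_comm]
      exact h1
    calc ENNReal.ofReal _ ≤ ENNReal.ofReal (P.real A) := ENNReal.ofReal_le_ofReal h2
      _ = P A := ofReal_measureReal
  calc ∫⁻ ω, Y ω * ENNReal.ofReal (Real.exp (s * e ω - s ^ 2 / 2)) ∂P
      = ∫⁻ ω, Y ω ∂(P.withDensity fun ω =>
          ENNReal.ofReal (Real.exp (s * e ω - s ^ 2 / 2))) := by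
        rw [lintegral_withDensity_eq_lintegral_mul _ hf (hY.mono hm le_rfl)]
        simp only [Pi.mul_apply, mul_comm]
    _ = ∫⁻ ω, Y ω ∂(P.withDensity fun ω =>
          ENNReal.ofReal (Real.exp (s * e ω - s ^ 2 / 2))).trim hm := (lintegral_trim hm hY).symm
    _ ≤ ∫⁻ ω, Y ω ∂P.trim hm := lintegral_mono' hμ le_rfl
    _ = ∫⁻ ω, Y ω ∂P := lintegral_trim hm hY

/-- The sub-Gaussian bound for a predictable exponent taking finitely many values. -/
theorem lintegral_mul_exp_finite_range_le (hm : m₀ ≤ m) {e : Ω → ℝ} (he : Measurable[m] e)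
    (hint : ∀ s : ℝ, Integrable (fun ω => Real.exp (s * e ω)) P)
    (hle : ∀ s : ℝ, ∀ᵐ ω ∂P,
      (P[fun ω' => Real.exp (s * e ω') | m₀]) ω ≤ Real.exp (s ^ 2 / 2))
    {Y : Ω → ENNReal} (hY : Measurable[m₀] Y) {l : Ω → ℝ}
    (hl : Measurable[m₀] l) (hfin : (Set.range l).Finite) :
    ∫⁻ ω, Y ω * ENNReal.ofReal (Real.exp (l ω * e ω - l ω ^ 2 / 2)) ∂P ≤ ∫⁻ ω, Y ω ∂P := by
  classical
  have hmeas : ∀ s, MeasurableSet[m₀] (l ⁻¹' {s}) := fun s =>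
    hl (measurableSet_singleton s)
  have hYi : ∀ s, Measurable[m₀] ((l ⁻¹' {s}).indicator Y) := fun s => hY.indicator (hmeas s)
  have hsum : ∀ F : Ω → ENNReal, ∀ ω,
      F ω = ∑ s ∈ hfin.toFinset, (l ⁻¹' {s}).indicator F ω := by
    intro F ω
    rw [Finset.sum_eq_single (l ω)]
    · exact (Set.indicator_of_mem (show ω ∈ l ⁻¹' {l ω} from rfl) F).symm
    · intro s _ hs
      exact Set.indicator_of_notMem (s := l ⁻¹' {s}) (fun h : l ω = s => hs h.symm) F
    · intro h
      exact absurd (hfin.mem_toFinset.2 (Set.mem_range_self ω)) h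
  calc ∫⁻ ω, Y ω * ENNReal.ofReal (Real.exp (l ω * e ω - l ω ^ 2 / 2)) ∂P
      = ∫⁻ ω, ∑ s ∈ hfin.toFinset, (l ⁻¹' {s}).indicator Y ω *
          ENNReal.ofReal (Real.exp (s * e ω - s ^ 2 / 2)) ∂P := by
        refine lintegral_congr fun ω => ?_
        rw [hsum (fun ω => Y ω * ENNReal.ofReal (Real.exp (l ω * e ω - l ω ^ 2 / 2))) ω]
        refine Finset.sum_congr rfl fun s _ => ?_
        by_cases h : ω ∈ l ⁻¹' {s}
        · rw [Set.indicator_of_mem h, Set.indicator_of_mem h]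
          have : l ω = s := h
          rw [this]
        · rw [Set.indicator_of_notMem h, Set.indicator_of_notMem h, zero_mul]
    _ = ∑ s ∈ hfin.toFinset, ∫⁻ ω, (l ⁻¹' {s}).indicator Y ω *
          ENNReal.ofReal (Real.exp (s * e ω - s ^ 2 / 2)) ∂P := by
        refine lintegral_finsetSum _ fun s _ => ?_
        exact ((hYi s).mono hm le_rfl).mul (by fun_prop)
    _ ≤ ∑ s ∈ hfin.toFinset, ∫⁻ ω, (l ⁻¹' {s}).indicator Y ω ∂P :=
        Finset.sum_le_sum fun s _ =>
          lintegral_mul_exp_le_of_condExp_exp_le hm he (hint s) (hle s) (hYi s)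
    _ = ∫⁻ ω, ∑ s ∈ hfin.toFinset, (l ⁻¹' {s}).indicator Y ω ∂P :=
        (lintegral_finsetSum _ fun s _ => (hYi s).mono hm le_rfl).symm
    _ = ∫⁻ ω, Y ω ∂P := lintegral_congr fun ω => (hsum Y ω).symm

/-- The sub-Gaussian bound for a predictable exponent. -/
theorem lintegral_mul_exp_predictable_le (hm : m₀ ≤ m) {e : Ω → ℝ} (he : Measurable[m] e)
    (hint : ∀ s : ℝ, Integrable (fun ω => Real.exp (s * e ω)) P)
    (hle : ∀ s : ℝ, ∀ᵐ ω ∂P,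
      (P[fun ω' => Real.exp (s * e ω') | m₀]) ω ≤ Real.exp (s ^ 2 / 2))
    {Y : Ω → ENNReal} (hY : Measurable[m₀] Y) (hYtop : ∀ ω, Y ω ≠ ⊤)
    {l : Ω → ℝ} (hl : Measurable[m₀] l) :
    ∫⁻ ω, Y ω * ENNReal.ofReal (Real.exp (l ω * e ω - l ω ^ 2 / 2)) ∂P ≤ ∫⁻ ω, Y ω ∂P := by
  set u : ℕ → @SimpleFunc Ω m₀ ℝ := fun k =>
    @SimpleFunc.approxOn ℝ Ω _ _ _ m₀ l hl Set.univ 0 (Set.mem_univ _) _ k with hu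
  have hlim : ∀ ω, Filter.Tendsto (fun k => u k ω) Filter.atTop (nhds (l ω)) := fun ω =>
    @SimpleFunc.tendsto_approxOn ℝ Ω _ _ _ m₀ l hl Set.univ 0 (Set.mem_univ _) _ ω (by simp)
  have hlim' : ∀ ω, Filter.Tendsto
      (fun k => Y ω * ENNReal.ofReal (Real.exp (u k ω * e ω - u k ω ^ 2 / 2))) Filter.atTop
      (nhds (Y ω * ENNReal.ofReal (Real.exp (l ω * e ω - l ω ^ 2 / 2)))) := by
    intro ω
    refine ENNReal.Tendsto.const_mul ?_ (Or.inr (hYtop ω))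
    refine ENNReal.tendsto_ofReal ?_
    exact (Real.continuous_exp.tendsto _).comp
      (((hlim ω).mul_const _).sub (((hlim ω).pow 2).div_const _))
  have humeas : ∀ k, Measurable[m] (u k) := fun k =>
    (@SimpleFunc.measurable Ω ℝ m₀ _ (u k)).mono hm le_rfl
  calc ∫⁻ ω, Y ω * ENNReal.ofReal (Real.exp (l ω * e ω - l ω ^ 2 / 2)) ∂P
      = ∫⁻ ω, Filter.liminf (fun k => Y ω *
          ENNReal.ofReal (Real.exp (u k ω * e ω - u k ω ^ 2 / 2))) Filter.atTop ∂P :=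
        lintegral_congr fun ω => (hlim' ω).liminf_eq.symm
    -- Fatou's lemma along simple approximations of the exponent. Finiteness of Y makes the products
    -- converge pointwise.
    _ ≤ Filter.liminf (fun k => ∫⁻ ω, Y ω *
          ENNReal.ofReal (Real.exp (u k ω * e ω - u k ω ^ 2 / 2)) ∂P) Filter.atTop := by
        refine lintegral_liminf_le fun k => ?_
        have := humeas k
        exact (hY.mono hm le_rfl).mul (by fun_prop)
    _ ≤ Filter.liminf (fun _ : ℕ => ∫⁻ ω, Y ω ∂P) Filter.atTop := by
        refine Filter.liminf_le_liminf (Filter.Eventually.of_forall fun k => ?_)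
        exact lintegral_mul_exp_finite_range_le hm he hint hle hY (@SimpleFunc.measurable Ω ℝ m₀ _ (u k))
          (@SimpleFunc.finite_range Ω ℝ m₀ (u k))
    _ = ∫⁻ ω, Y ω ∂P := Filter.liminf_const _

/-- One step of the Gaussian mixture supermartingale. -/
theorem lintegral_mul_mixture_step_le (hm : m₀ ≤ m) {e : Ω → ℝ} (he : Measurable[m] e)
    (hint : ∀ s : ℝ, Integrable (fun ω => Real.exp (s * e ω)) P)
    (hle : ∀ s : ℝ, ∀ᵐ ω ∂P,
      (P[fun ω' => Real.exp (s * e ω') | m₀]) ω ≤ Real.exp (s ^ 2 / 2))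
    {Y : Ω → ENNReal} (hY : Measurable[m₀] Y) (hYtop : ∀ ω, Y ω ≠ ⊤)
    {a w : Ω → ℝ} (ha : Measurable[m₀] a) (hw : Measurable[m₀] w) (hw0 : ∀ ω, 0 ≤ w ω) :
    ∫⁻ ω, Y ω * ENNReal.ofReal
      (Real.exp ((2 * e ω * a ω + e ω ^ 2 * w ω - a ω ^ 2) / (1 + w ω) / 2) / √(1 + w ω)) ∂P ≤
      ∫⁻ ω, Y ω ∂P := by
  have hY' : Measurable[m] Y := hY.mono hm le_rfl
  have ha' : Measurable[m] a := ha.mono hm le_rfl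
  have hw' : Measurable[m] w := hw.mono hm le_rfl
  simp only [← lintegral_exp_gaussianReal (hw0 _)]
  calc ∫⁻ ω, Y ω * ∫⁻ ξ, ENNReal.ofReal (Real.exp ((a ω + √(w ω) * ξ) * e ω -
          (a ω + √(w ω) * ξ) ^ 2 / 2)) ∂(ProbabilityTheory.gaussianReal 0 1) ∂P
      = ∫⁻ ω, ∫⁻ ξ, Y ω * ENNReal.ofReal (Real.exp ((a ω + √(w ω) * ξ) * e ω -
          (a ω + √(w ω) * ξ) ^ 2 / 2)) ∂(ProbabilityTheory.gaussianReal 0 1) ∂P := by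
        refine lintegral_congr fun ω => (lintegral_const_mul _ ?_).symm
        fun_prop
    _ = ∫⁻ ξ, ∫⁻ ω, Y ω * ENNReal.ofReal (Real.exp ((a ω + √(w ω) * ξ) * e ω -
          (a ω + √(w ω) * ξ) ^ 2 / 2)) ∂P ∂(ProbabilityTheory.gaussianReal 0 1) := by
        -- After Tonelli the auxiliary Gaussian ξ is fixed, and a + √w ξ is a predictable exponent.
        refine lintegral_lintegral_swap (Measurable.aemeasurable ?_)
        unfold Function.uncurry
        fun_prop
    _ ≤ ∫⁻ ξ, (∫⁻ ω, Y ω ∂P) ∂(ProbabilityTheory.gaussianReal 0 1) := by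
        refine lintegral_mono fun ξ => ?_
        exact lintegral_mul_exp_predictable_le hm he hint hle hY hYtop
          (ha.add (hw.sqrt.mul_const ξ))
    _ = ∫⁻ ω, Y ω ∂P := by simp

end ConditionalSubGaussian

/-! ### Ville's inequality. -/

section MaximalInequality

variable {Ω : Type*} {m : MeasurableSpace Ω} {P : Measure Ω}

/-- Ville's maximal inequality over a finite horizon. -/
theorem mul_measure_exists_le_of_supermartingale (ℱ : Filtration ℕ m) {N : ℕ → Ω → ENNReal}
    {n : ℕ} (hN : ∀ t ≤ n, Measurable[ℱ t] (N t))
    (hstep : ∀ t < n, ∀ A, MeasurableSet[ℱ t] A → ∫⁻ ω in A, N (t + 1) ω ∂P ≤ ∫⁻ ω in A, N t ω ∂P)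
    (c : ENNReal) :
    c * P {ω | ∃ t ≤ n, c ≤ N t ω} ≤ ∫⁻ ω, N 0 ω ∂P := by
  have hcross : ∀ t ≤ n, MeasurableSet[ℱ t] {ω | ∃ s ≤ t, c ≤ N s ω} := by
    intro t ht
    have : {ω | ∃ s ≤ t, c ≤ N s ω} = ⋃ s ∈ Set.Iic t, {ω | c ≤ N s ω} := by
      ext ω; simp
    rw [this]
    refine MeasurableSet.biUnion (Set.to_countable _) fun s hs => ?_
    exact ℱ.mono hs _ (measurableSet_le measurable_const (hN s (le_trans hs ht)))
  -- This invariant replaces stopping times: mass c is charged where the level has been reached, and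
  -- the process itself is kept elsewhere. Each step moves the newly crossing points from the second
  -- term to the first.
  have key : ∀ t ≤ n, c * P {ω | ∃ s ≤ t, c ≤ N s ω} +
      ∫⁻ ω in {ω | ∃ s ≤ t, c ≤ N s ω}ᶜ, N t ω ∂P ≤ ∫⁻ ω, N 0 ω ∂P := by
    intro t
    induction t with
    | zero =>
      intro ht
      rw [← lintegral_add_compl (μ := P) (N 0) (ℱ.le 0 _ (hcross 0 ht))]
      refine add_le_add ?_ le_rfl
      refine le_trans ?_ (setLIntegral_mono_ae' (ℱ.le 0 _ (hcross 0 ht)) (f := fun _ => c)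
        (Filter.Eventually.of_forall fun ω hω => ?_))
      · rw [setLIntegral_const]
      · obtain ⟨s, hs, h⟩ := hω
        rwa [Nat.le_zero.1 hs] at h
    | succ t ih =>
      intro ht
      have ih' := ih (by omega)
      refine le_trans ?_ ih'
      set A := {ω | ∃ s ≤ t, c ≤ N s ω} with hA
      set B := {ω | ∃ s ≤ t + 1, c ≤ N s ω} with hB
      have hAm := ℱ.le t _ (hcross t (by omega))
      have hBm := ℱ.le (t + 1) _ (hcross (t + 1) ht)
      have hAB : A ⊆ B := fun ω ⟨s, hs, h⟩ => ⟨s, by omega, h⟩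
      have h1 := hstep t (by omega) Aᶜ (hcross t (by omega)).compl
      have h2 : P B = P A + P (B \ A) := by
        rw [← measure_inter_add_sdiff B hAm, Set.inter_eq_right.2 hAB]
      have h3 : ∫⁻ ω in Aᶜ, N (t + 1) ω ∂P =
          ∫⁻ ω in B \ A, N (t + 1) ω ∂P + ∫⁻ ω in Bᶜ, N (t + 1) ω ∂P := by
        rw [← lintegral_inter_add_sdiff (N (t + 1)) Aᶜ hBm]
        congr 2
        · rw [Set.sdiff_eq, Set.inter_comm]
        · rw [Set.sdiff_eq, ← Set.compl_union, Set.union_eq_right.2 hAB]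
      have h4 : c * P (B \ A) ≤ ∫⁻ ω in B \ A, N (t + 1) ω ∂P := by
        rw [← setLIntegral_const]
        refine setLIntegral_mono_ae' (hBm.diff hAm)
          (Filter.Eventually.of_forall fun ω hω => ?_)
        obtain ⟨⟨s, hs, h⟩, hnA⟩ := hω
        rcases Nat.lt_or_ge t s with h' | h'
        · rwa [show s = t + 1 by omega] at h
        · exact absurd ⟨s, h', h⟩ hnA
      rw [h2, mul_add, add_assoc]
      gcongr
      refine le_trans ?_ h1
      rw [h3]
      gcongr
  exact le_trans le_self_add (key n le_rfl)

end MaximalInequality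

/-! ### Measurability of determinants, inverses and quadratic forms. -/

section MatrixMeasurability

variable {Ω : Type*} {m : MeasurableSpace Ω} {n : Type*} [Fintype n] [DecidableEq n]

theorem measurable_matrix_det {M : Ω → Matrix n n ℝ} (hM : ∀ i j, Measurable fun ω => M ω i j) :
    Measurable fun ω => (M ω).det := by
  simp only [Matrix.det_apply]
  exact Finset.measurable_sum _ fun s _ =>
    (Finset.measurable_prod _ fun i _ => hM _ _).const_smul _

theorem measurable_matrix_inv {M : Ω → Matrix n n ℝ} (hM : ∀ i j, Measurable fun ω => M ω i j)
    (i j : n) : Measurable fun ω => (M ω)⁻¹ i j := by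
  simp only [Matrix.inv_def, Ring.inverse_eq_inv', Matrix.smul_apply, smul_eq_mul,
    Matrix.adjugate_apply]
  refine (measurable_matrix_det hM).inv.mul (measurable_matrix_det fun k l => ?_)
  by_cases hk : k = j
  · subst hk
    simp only [Matrix.updateRow_self]
    exact measurable_const
  · simp only [Matrix.updateRow_ne hk]
    exact hM k l

omit [DecidableEq n] in
theorem measurable_dotProduct_mulVec {M : Ω → Matrix n n ℝ} {u v : Ω → n → ℝ}
    (hM : ∀ i j, Measurable fun ω => M ω i j) (hu : ∀ i, Measurable fun ω => u ω i)
    (hv : ∀ i, Measurable fun ω => v ω i) : Measurable fun ω => u ω ⬝ᵥ (M ω *ᵥ v ω) := by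
  simp only [dotProduct, Matrix.mulVec]
  exact Finset.measurable_sum _ fun i _ => (hu i).mul
    (Finset.measurable_sum _ fun j _ => (hM i j).mul (hv j))

end MatrixMeasurability

/-! ### Self-normalized concentration by the method of mixtures. -/

section SelfNormalized

variable {d : ℕ} {Ω : Type*}

theorem measurable_designMatrix_apply {m : MeasurableSpace Ω} {z : ℕ → Ω → Param d} {t : ℕ}
    (hz : ∀ τ ∈ Finset.Icc 1 t, Measurable (z τ)) (i j : Fin d ⊕ Fin d) :
    Measurable fun ω => designMatrix 1 (fun τ => z τ ω) t i j := by
  simp only [designMatrix, one_smul, Matrix.add_apply, Matrix.sum_apply, Matrix.vecMulVec_apply]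
  refine measurable_const.add (Finset.measurable_sum _ fun τ hτ => ?_)
  have := hz τ hτ
  fun_prop

/-- The Gaussian mixture process `exp(‖S‖²_{M⁻¹} / 2) / √(det M)` with `S = ∑ e_τ z_τ`. -/
noncomputable def mixtureProcess (z : ℕ → Param d) (e : ℕ → ℝ) (t : ℕ) : ℝ :=
  Real.exp (WithLp.ofLp (∑ τ ∈ Finset.Icc 1 t, e τ • z τ) ⬝ᵥ ((designMatrix 1 z t)⁻¹ *ᵥ
    WithLp.ofLp (∑ τ ∈ Finset.Icc 1 t, e τ • z τ)) / 2) / √(designMatrix 1 z t).det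

theorem mixtureProcess_zero (z : ℕ → Param d) (e : ℕ → ℝ) : mixtureProcess z e 0 = 1 := by
  simp [mixtureProcess, designMatrix_zero]

theorem mixtureProcess_nonneg (z : ℕ → Param d) (e : ℕ → ℝ) (t : ℕ) :
    0 ≤ mixtureProcess z e t := by
  unfold mixtureProcess
  positivity

/-- The factor is the one-step Gaussian mixture: a and w are the mean and variance of zᵀθ when θ has
the normal law with mean M⁻¹S and covariance M⁻¹. Hence a scalar Gaussian at each step replaces a
vector-valued mixture. -/
theorem mixtureProcess_succ (z : ℕ → Param d) (e : ℕ → ℝ) (t : ℕ) {a w : ℝ}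
    (ha : a = WithLp.ofLp (z (t + 1)) ⬝ᵥ ((designMatrix 1 z t)⁻¹ *ᵥ
      WithLp.ofLp (∑ τ ∈ Finset.Icc 1 t, e τ • z τ)))
    (hw : w = WithLp.ofLp (z (t + 1)) ⬝ᵥ ((designMatrix 1 z t)⁻¹ *ᵥ WithLp.ofLp (z (t + 1)))) :
    mixtureProcess z e (t + 1) = mixtureProcess z e t *
      (Real.exp ((2 * e (t + 1) * a + e (t + 1) ^ 2 * w - a ^ 2) / (1 + w) / 2) / √(1 + w)) := by
  have hP := designMatrix_posDef z t
  unfold mixtureProcess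
  rw [Finset.sum_Icc_succ_top (by omega), designMatrix_succ, WithLp.ofLp_add, WithLp.ofLp_smul,
    hP.dotProduct_inv_add_vecMulVec, hP.det_add_vecMulVec, ← ha, ← hw, add_div, Real.exp_add,
    Real.sqrt_mul hP.det_pos.le, mul_div_mul_comm]

theorem measurable_mixtureProcess {m : MeasurableSpace Ω} {z : ℕ → Ω → Param d}
    {e : ℕ → Ω → ℝ} {t : ℕ} (hz : ∀ τ ∈ Finset.Icc 1 t, Measurable (z τ))
    (he : ∀ τ ∈ Finset.Icc 1 t, Measurable (e τ)) :
    Measurable fun ω => mixtureProcess (fun τ => z τ ω) (fun τ => e τ ω) t := by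
  have hS : Measurable fun ω => ∑ τ ∈ Finset.Icc 1 t, e τ ω • z τ ω :=
    Finset.measurable_sum _ fun τ hτ => (he τ hτ).smul (hz τ hτ)
  have hM := measurable_designMatrix_apply hz
  unfold mixtureProcess
  refine Measurable.div (Measurable.exp (Measurable.div_const ?_ _)) (measurable_matrix_det hM).sqrt
  exact measurable_dotProduct_mulVec (measurable_matrix_inv hM) (fun i => by fun_prop)
    (fun i => by fun_prop)

/-- Self-normalized concentration for vector-valued martingales, uniform over a finite horizon. -/
theorem exists_measurable_self_normalized_bound {m : MeasurableSpace Ω} {P : Measure Ω}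
    [IsProbabilityMeasure P] {ℱ : Filtration ℕ m} {ε : ℕ → Ω → ℝ} {σ : ℝ} (hσ : 0 < σ) {T : ℕ}
    (hε : IsSubGaussianMDS P ℱ ε σ T) {z : ℕ → Ω → Param d}
    (hz : ∀ t ∈ Finset.Icc 1 T, Measurable[ℱ (t - 1)] (z t)) {c : ℝ} (hc : 0 < c) :
    ∃ B : Set Ω, MeasurableSet B ∧ P B ≤ ENNReal.ofReal c⁻¹ ∧ ∀ ω ∉ B, ∀ t ≤ T,
      matNorm (designMatrix 1 (fun τ => z τ ω) t)⁻¹ (∑ τ ∈ Finset.Icc 1 t, ε τ ω • z τ ω) ≤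
        σ * √(2 * Real.log c + Real.log (designMatrix 1 (fun τ => z τ ω) t).det) := by
  -- Rescaling by σ reduces to variance proxy 1.
  set e : ℕ → Ω → ℝ := fun t ω => ε t ω / σ with he
  set N : ℕ → Ω → ENNReal := fun t ω =>
    ENNReal.ofReal (mixtureProcess (fun τ => z τ ω) (fun τ => e τ ω) t) with hNdef
  have hzm : ∀ t ≤ T, ∀ τ ∈ Finset.Icc 1 t, Measurable[ℱ t] (z τ) := by
    intro t ht τ hτ
    rw [Finset.mem_Icc] at hτ
    exact (hz τ (Finset.mem_Icc.2 ⟨hτ.1, hτ.2.trans ht⟩)).mono (ℱ.mono (by omega)) le_rfl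
  have hem : ∀ t ≤ T, ∀ τ ∈ Finset.Icc 1 t, Measurable[ℱ t] (e τ) := by
    intro t ht τ hτ
    rw [Finset.mem_Icc] at hτ
    exact ((hε.meas τ (Finset.mem_Icc.2 ⟨hτ.1, hτ.2.trans ht⟩)).mono (ℱ.mono hτ.2)
      le_rfl).div_const σ
  have hN : ∀ t ≤ T, Measurable[ℱ t] (N t) := fun t ht =>
    (measurable_mixtureProcess (hzm t ht) (hem t ht)).ennreal_ofReal
  have hstep : ∀ t < T, ∀ A, MeasurableSet[ℱ t] A →
      ∫⁻ ω in A, N (t + 1) ω ∂P ≤ ∫⁻ ω in A, N t ω ∂P := by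
    intro t ht A hA
    have htmem : t + 1 ∈ Finset.Icc 1 T := Finset.mem_Icc.2 ⟨by omega, ht⟩
    have hz' : Measurable[ℱ t] (z (t + 1)) := hz (t + 1) htmem
    have hM := measurable_designMatrix_apply (hzm t ht.le)
    have hS : Measurable[ℱ t] fun ω => ∑ τ ∈ Finset.Icc 1 t, e τ ω • z τ ω :=
      Finset.measurable_sum _ fun τ hτ => (hem t ht.le τ hτ).smul (hzm t ht.le τ hτ)
    have hzi : ∀ i, Measurable[ℱ t] fun ω => WithLp.ofLp (z (t + 1) ω) i := fun i => by fun_prop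
    have hSi : ∀ i, Measurable[ℱ t] fun ω =>
        WithLp.ofLp (∑ τ ∈ Finset.Icc 1 t, e τ ω • z τ ω) i := fun i => by fun_prop
    have hemeas : Measurable (e (t + 1)) :=
      ((hε.meas (t + 1) htmem).mono (ℱ.le _) le_rfl).div_const σ
    have hscale : ∀ s : ℝ, (fun ω => Real.exp (s * e (t + 1) ω)) =
        fun ω => Real.exp (s / σ * ε (t + 1) ω) := fun s => by
      funext ω
      rw [he]
      congr 1
      ring
    have hcond : ∀ s : ℝ, ∀ᵐ ω ∂P,
        (P[fun ω' => Real.exp (s * e (t + 1) ω') | ℱ t]) ω ≤ Real.exp (s ^ 2 / 2) := by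
      intro s
      rw [hscale]
      filter_upwards [hε.condExp_exp_le (t + 1) htmem (s / σ)] with ω hω
      have : σ ^ 2 * (s / σ) ^ 2 / 2 = s ^ 2 / 2 := by field_simp
      rwa [this] at hω
    have h := lintegral_mul_mixture_step_le (ℱ.le t) hemeas
      (fun s => by rw [hscale]; exact hε.integrable_exp (t + 1) htmem _) hcond
      -- The indicator of A localizes the one-step inequality, giving the supermartingale property
      -- on every event of the past.
      (Y := A.indicator (N t)) ((hN t ht.le).indicator hA)
      (fun ω => by
        by_cases hω : ω ∈ A
        · rw [Set.indicator_of_mem hω]; exact ENNReal.ofReal_ne_top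
        · rw [Set.indicator_of_notMem hω]; exact ENNReal.zero_ne_top)
      (measurable_dotProduct_mulVec (measurable_matrix_inv hM) hzi hSi)
      (measurable_dotProduct_mulVec (measurable_matrix_inv hM) hzi hzi)
      (fun ω => (designMatrix_posDef _ t).inv.dotProduct_mulVec_nonneg_real _)
    rw [lintegral_indicator (ℱ.le t _ hA)] at h
    refine le_trans (le_of_eq ?_) h
    rw [← lintegral_indicator (ℱ.le t _ hA)]
    refine lintegral_congr fun ω => ?_
    by_cases hω : ω ∈ A
    · rw [Set.indicator_of_mem hω, Set.indicator_of_mem hω, hNdef]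
      simp only
      rw [← ENNReal.ofReal_mul (mixtureProcess_nonneg _ _ _), mixtureProcess_succ _ _ _ rfl rfl]
    · rw [Set.indicator_of_notMem hω, Set.indicator_of_notMem hω, zero_mul]
  have hville := mul_measure_exists_le_of_supermartingale ℱ hN hstep (ENNReal.ofReal c)
  have hN0 : ∫⁻ ω, N 0 ω ∂P = 1 := by
    simp [hNdef, mixtureProcess_zero]
  rw [hN0] at hville
  refine ⟨toMeasurable P {ω | ∃ t ≤ T, ENNReal.ofReal c ≤ N t ω}, measurableSet_toMeasurable _ _,
    ?_, ?_⟩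
  · rw [measure_toMeasurable, ENNReal.ofReal_inv_of_pos hc]
    exact ENNReal.le_inv_iff_mul_le.2 (by rwa [mul_comm])
  · intro ω hω t ht
    have hω' : ω ∉ {ω | ∃ t ≤ T, ENNReal.ofReal c ≤ N t ω} :=
      fun h => hω (subset_toMeasurable _ _ h)
    have hlt : mixtureProcess (fun τ => z τ ω) (fun τ => e τ ω) t < c := by
      by_contra hcon
      exact hω' ⟨t, ht, ENNReal.ofReal_le_ofReal (not_lt.1 hcon)⟩
    set M := designMatrix 1 (fun τ => z τ ω) t with hMdef
    have hP : M.PosDef := designMatrix_posDef _ t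
    have hsum : ∑ τ ∈ Finset.Icc 1 t, ε τ ω • z τ ω =
        σ • ∑ τ ∈ Finset.Icc 1 t, e τ ω • z τ ω := by
      rw [Finset.smul_sum]
      refine Finset.sum_congr rfl fun τ _ => ?_
      rw [smul_smul, he]
      congr 1
      field_simp
    rw [hsum]
    set S := ∑ τ ∈ Finset.Icc 1 t, e τ ω • z τ ω with hS
    set Q := WithLp.ofLp S ⬝ᵥ (M⁻¹ *ᵥ WithLp.ofLp S) with hQ
    have hmix : mixtureProcess (fun τ => z τ ω) (fun τ => e τ ω) t =
      Real.exp (Q / 2) / √M.det := rfl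
    rw [hmix, div_lt_iff₀ (Real.sqrt_pos.2 hP.det_pos)] at hlt
    have hlog := Real.log_lt_log (Real.exp_pos _) hlt
    rw [Real.log_exp, Real.log_mul hc.ne' (Real.sqrt_pos.2 hP.det_pos).ne',
      Real.log_sqrt hP.det_pos.le] at hlog
    have hm : matNorm M⁻¹ (σ • S) = σ * √Q := by
      rw [matNorm, WithLp.ofLp_smul, Matrix.mulVec_smul, dotProduct_smul, smul_dotProduct,
        smul_eq_mul, smul_eq_mul, ← hQ, ← mul_assoc, Real.sqrt_mul (mul_self_nonneg σ),
        Real.sqrt_mul_self hσ.le]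
    rw [hm]
    gcongr
    linarith

end SelfNormalized

/-! ### Revenue loss of a price and validity of the confidence set. -/

section Pricing

variable {d : ℕ} {g : ℝ → ℝ} {Θ : Set (Param d)} {𝒳 : Set (Covariate d)}
  {pstar : Param d → Covariate d → ℝ} {θbar plow phigh glow ghigh σ : ℝ}

theorem IsOptimalPricing.isGreatest (hpstar : IsOptimalPricing g Θ 𝒳 pstar) {θ : Param d}
    (hθ : θ ∈ Θ) {x : Covariate d} (hx : x ∈ 𝒳) :
    IsGreatest ((fun p => revenue g p θ x) '' Set.Ici 0) (revenue g (pstar θ x) θ x) := by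
  refine ⟨⟨_, (hpstar θ hθ x hx).1, rfl⟩, ?_⟩
  rintro _ ⟨p, hp, rfl⟩
  exact (hpstar θ hθ x hx).2 hp

theorem IsOptimalPricing.optRevenue_eq (hpstar : IsOptimalPricing g Θ 𝒳 pstar) {θ : Param d}
    (hθ : θ ∈ Θ) {x : Covariate d} (hx : x ∈ 𝒳) :
    optRevenue g θ x = revenue g (pstar θ x) θ x :=
  (hpstar.isGreatest hθ hx).csSup_eq

/-- By convexity of Θ, every value between two linear predictors is the predictor of a point of Θ,
so the bounds on g' hold along the whole interval. -/
theorem uIcc_inner_subset_image (hΘconv : Convex ℝ Θ) (z : Param d) {θ₁ θ₂ : Param d}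
    (h₁ : θ₁ ∈ Θ) (h₂ : θ₂ ∈ Θ) :
    Set.uIcc (inner ℝ z θ₂) (inner ℝ z θ₁) ⊆ (fun θ => inner ℝ z θ) '' Θ := by
  have h : Convex ℝ ((innerSL ℝ z).toLinearMap '' Θ) := hΘconv.linear_image _
  exact h.ordConnected.uIcc_subset ⟨θ₂, h₂, rfl⟩ ⟨θ₁, h₁, rfl⟩

theorem forall_uIcc_deriv_bounds (hΘconv : Convex ℝ Θ)
    (hg : ∀ x ∈ 𝒳, ∀ θ ∈ Θ, ∀ p ∈ Set.Icc plow phigh,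
      glow ≤ deriv g (linPred θ x p) ∧ deriv g (linPred θ x p) ≤ ghigh)
    {x : Covariate d} (hx : x ∈ 𝒳) {p : ℝ} (hp : p ∈ Set.Icc plow phigh) {θ₁ θ₂ : Param d}
    (h₁ : θ₁ ∈ Θ) (h₂ : θ₂ ∈ Θ) :
    ∀ v ∈ Set.uIcc (inner ℝ (feature x p) θ₂) (inner ℝ (feature x p) θ₁),
      glow ≤ deriv g v ∧ deriv g v ≤ ghigh := by
  intro v hv
  obtain ⟨θ, hθ, rfl⟩ := uIcc_inner_subset_image hΘconv _ h₁ h₂ hv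
  simp only [inner_feature]
  exact hg x hx θ hθ p hp

theorem abs_link_sub_le (hΘconv : Convex ℝ Θ) (hgdiff : Differentiable ℝ g) (hglow : 0 < glow)
    (hg : ∀ x ∈ 𝒳, ∀ θ ∈ Θ, ∀ p ∈ Set.Icc plow phigh,
      glow ≤ deriv g (linPred θ x p) ∧ deriv g (linPred θ x p) ≤ ghigh)
    {x : Covariate d} (hx : x ∈ 𝒳) {p : ℝ} (hp : p ∈ Set.Icc plow phigh) {θ₁ θ₂ : Param d}
    (h₁ : θ₁ ∈ Θ) (h₂ : θ₂ ∈ Θ) :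
    |g (linPred θ₁ x p) - g (linPred θ₂ x p)| ≤ ghigh * |inner ℝ (feature x p) (θ₁ - θ₂)| := by
  have h := (convex_uIcc (inner ℝ (feature x p) θ₂)
    (inner ℝ (feature x p) θ₁)).norm_image_sub_le_of_norm_deriv_le (f := g) (C := ghigh)
    (fun v _ => hgdiff v) (fun v hv => by
      have := forall_uIcc_deriv_bounds hΘconv hg hx hp h₁ h₂ v hv
      rw [Real.norm_of_nonneg (hglow.le.trans this.1)]
      exact this.2) Set.left_mem_uIcc Set.right_mem_uIcc
  rw [Real.norm_eq_abs, Real.norm_eq_abs, ← inner_sub_right, inner_feature, inner_feature] at h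
  exact h

/-- The loss of an optimistic price is controlled by the prediction error at that price. -/
theorem optRevenue_sub_le_of_optimistic (hΘconv : Convex ℝ Θ)
    (hpstar : IsOptimalPricing g Θ 𝒳 pstar)
    (hpint : ∀ θ ∈ Θ, ∀ x ∈ 𝒳, pstar θ x ∈ Set.Ioo plow phigh)
    (hgdiff : Differentiable ℝ g) (hglow : 0 < glow)
    (hg : ∀ x ∈ 𝒳, ∀ θ ∈ Θ, ∀ p ∈ Set.Icc plow phigh,
      glow ≤ deriv g (linPred θ x p) ∧ deriv g (linPred θ x p) ≤ ghigh)
    {x : Covariate d} (hx : x ∈ 𝒳) {θ₁ θ₂ : Param d} (h₁ : θ₁ ∈ Θ) (h₂ : θ₂ ∈ Θ)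
    (hopt : optRevenue g θ₁ x ≤ optRevenue g θ₂ x) :
    optRevenue g θ₁ x - revenue g (pstar θ₂ x) θ₁ x ≤
      phigh * ghigh * |inner ℝ (feature x (pstar θ₂ x)) (θ₂ - θ₁)| := by
  have hp := hpint θ₂ h₂ x hx
  have hp0 := (hpstar θ₂ h₂ x hx).1
  have hl := abs_link_sub_le hΘconv hgdiff hglow hg hx (Set.Ioo_subset_Icc_self hp) h₂ h₁
  rw [hpstar.optRevenue_eq h₂ hx] at hopt
  calc optRevenue g θ₁ x - revenue g (pstar θ₂ x) θ₁ x
      ≤ revenue g (pstar θ₂ x) θ₂ x - revenue g (pstar θ₂ x) θ₁ x := by linarith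
    _ = pstar θ₂ x * (g (linPred θ₂ x (pstar θ₂ x)) - g (linPred θ₁ x (pstar θ₂ x))) := by
        simp only [revenue]; ring
    _ ≤ phigh * (ghigh * |inner ℝ (feature x (pstar θ₂ x)) (θ₂ - θ₁)|) :=
        (mul_le_mul_of_nonneg_left ((le_abs_self _).trans hl) hp0).trans
          (mul_le_mul_of_nonneg_right hp.2.le ((abs_nonneg _).trans hl))
    _ = _ := by ring

/-- Bound on the loss of a price that is optimal for an arbitrary parameter of `Θ`. -/
theorem optRevenue_sub_le (hΘconv : Convex ℝ Θ) (hΘ : ∀ θ ∈ Θ, ‖θ‖ ≤ θbar)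
    (hpstar : IsOptimalPricing g Θ 𝒳 pstar)
    (hpint : ∀ θ ∈ Θ, ∀ x ∈ 𝒳, pstar θ x ∈ Set.Ioo plow phigh)
    (hz : ∀ x ∈ 𝒳, ∀ p ∈ Set.Icc plow phigh, ‖feature x p‖ ≤ 1)
    (hgdiff : Differentiable ℝ g) (hglow : 0 < glow)
    (hg : ∀ x ∈ 𝒳, ∀ θ ∈ Θ, ∀ p ∈ Set.Icc plow phigh,
      glow ≤ deriv g (linPred θ x p) ∧ deriv g (linPred θ x p) ≤ ghigh)
    {x : Covariate d} (hx : x ∈ 𝒳) {θ₁ θ₂ : Param d} (h₁ : θ₁ ∈ Θ) (h₂ : θ₂ ∈ Θ) :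
    optRevenue g θ₁ x - revenue g (pstar θ₂ x) θ₁ x ≤ 4 * phigh * ghigh * θbar := by
  have hp₂ := hpint θ₂ h₂ x hx
  have hp₁ := hpint θ₁ h₁ x hx
  have hgh : 0 < ghigh :=
    hglow.trans_le ((hg x hx θ₁ h₁ _ (Set.Ioo_subset_Icc_self hp₁)).1.trans
      (hg x hx θ₁ h₁ _ (Set.Ioo_subset_Icc_self hp₁)).2)
  have hin : ∀ p ∈ Set.Icc plow phigh, ∀ θ ∈ Θ, ∀ θ' ∈ Θ,
      |inner ℝ (feature x p) (θ - θ')| ≤ 2 * θbar := by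
    intro p hp θ hθ θ' hθ'
    calc |inner ℝ (feature x p) (θ - θ')| ≤ ‖feature x p‖ * ‖θ - θ'‖ :=
          abs_real_inner_le_norm _ _
      _ ≤ 1 * (‖θ‖ + ‖θ'‖) :=
          mul_le_mul (hz x hx p hp) (norm_sub_le _ _) (norm_nonneg _) zero_le_one
      _ ≤ 2 * θbar := by linarith [hΘ θ hθ, hΘ θ' hθ']
  have hdiff : ∀ p ∈ Set.Icc plow phigh, 0 ≤ p → ∀ θ ∈ Θ, ∀ θ' ∈ Θ,
      revenue g p θ x - revenue g p θ' x ≤ phigh * (ghigh * (2 * θbar)) := by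
    intro p hp hp0 θ hθ θ' hθ'
    have hl := (abs_link_sub_le hΘconv hgdiff hglow hg hx hp hθ hθ').trans
      (mul_le_mul_of_nonneg_left (hin p hp θ hθ θ' hθ') hgh.le)
    have he : revenue g p θ x - revenue g p θ' x =
        p * (g (linPred θ x p) - g (linPred θ' x p)) := by
      simp only [revenue]; ring
    rw [he]
    exact (mul_le_mul_of_nonneg_left ((le_abs_self _).trans hl) hp0).trans
      (mul_le_mul_of_nonneg_right hp.2 ((abs_nonneg _).trans hl))
  -- Exchanging the two parameters costs 2 p̄ ḡ θ̄ at either price; between the exchanges,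
  -- optimality of the charged price for θ₂ is used.
  have k₁ := hdiff _ (Set.Ioo_subset_Icc_self hp₁) (hpstar θ₁ h₁ x hx).1 θ₁ h₁ θ₂ h₂
  have k₂ := hdiff _ (Set.Ioo_subset_Icc_self hp₂) (hpstar θ₂ h₂ x hx).1 θ₂ h₂ θ₁ h₁
  have k₃ : revenue g (pstar θ₁ x) θ₂ x ≤ revenue g (pstar θ₂ x) θ₂ x :=
    (hpstar.isGreatest h₂ hx).2 ⟨_, (hpstar θ₁ h₁ x hx).1, rfl⟩
  rw [hpstar.optRevenue_eq h₁ hx]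
  linarith

theorem confRadius_one (T : ℕ) (M : Matrix (Fin d ⊕ Fin d) (Fin d ⊕ Fin d) ℝ) :
    confRadius 1 θbar σ glow T M =
      2 * θbar + 2 * σ / glow * √(2 * Real.log T + Real.log M.det) := by
  simp [confRadius]

theorem confRadius_le_alphaBar (hd : 1 ≤ d) (hσ : 0 < σ) (hglow : 0 < glow)
    {z : ℕ → Param d} {t T : ℕ} (htT : t ≤ T) (hz : ∀ τ ∈ Finset.Icc 1 t, ‖z τ‖ ≤ 1) :
    confRadius 1 θbar σ glow T (designMatrix 1 z t) ≤ alphaBar d θbar σ glow T := by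
  rw [confRadius_one, alphaBar]
  have h := log_det_designMatrix_le hd htT hz
  have h' : 0 ≤ 2 * σ / glow := by positivity
  exact add_le_add le_rfl (mul_le_mul_of_nonneg_left (Real.sqrt_le_sqrt (by linarith)) h')

theorem sqrt_two_div_mul (hglow : 0 < glow) (δ : ℝ) :
    √(2 / glow * δ) = √2 / √glow * √δ := by
  rw [Real.sqrt_mul (by positivity), Real.sqrt_div (by norm_num)]

/-- The true parameter lies within the confidence radius of the quasi-MLE. -/
theorem matNorm_sub_quasiMLE_le (hΘconv : Convex ℝ Θ) (hΘ : ∀ θ ∈ Θ, ‖θ‖ ≤ θbar)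
    (hgmono : StrictMono g) (hgdiff : Differentiable ℝ g) (hglow : 0 < glow) (hσ : 0 < σ)
    {z : ℕ → Param d} {D : ℕ → ℝ} {t T : ℕ} (hT : 1 ≤ T)
    (hm : ∀ τ ∈ Finset.Icc 1 t, ∀ θ₁ ∈ Θ, ∀ θ₂ ∈ Θ,
      ∀ v ∈ Set.uIcc (inner ℝ (z τ) θ₂) (inner ℝ (z τ) θ₁), glow ≤ deriv g v)
    (hint : ∀ τ ∈ Finset.Icc 1 t, ∀ θ ∈ Θ,
      IntervalIntegrable (likIntegrand g (D τ)) volume (D τ) (g (inner ℝ (z τ) θ)))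
    {θhat θ : Param d} (hhat : θhat ∈ Θ) (hmax : IsMaxOn (quasiObjective g 1 glow z D t) Θ θhat)
    (hθ : θ ∈ Θ)
    (hscore : matNorm (designMatrix 1 z t)⁻¹
        (∑ τ ∈ Finset.Icc 1 t, (D τ - g (inner ℝ (z τ) θ)) • z τ) ≤
      σ * √(2 * Real.log ((T : ℝ) ^ 4) + Real.log (designMatrix 1 z t).det)) :
    matNorm (designMatrix 1 z t) (θ - θhat) ≤
      confRadius 1 θbar σ glow T (designMatrix 1 z t) := by
  have h := quasiMLE_error_le hgmono hgdiff hglow hΘconv hm hint hhat hmax hθ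
  rw [← sq_matNorm_designMatrix] at h
  rw [confRadius_one]
  set M := designMatrix 1 z t with hM
  have hP : M.PosDef := designMatrix_posDef z t
  set S := ∑ τ ∈ Finset.Icc 1 t, (D τ - g (inner ℝ (z τ) θ)) • z τ with hS
  set X := matNorm M (θ - θhat) with hX
  set R := √(2 * Real.log T + Real.log M.det) with hR
  have hθbar : 0 ≤ θbar := (norm_nonneg θ).trans (hΘ θ hθ)
  have hX0 : 0 ≤ X := matNorm_nonneg _ _
  have hR0 : 0 ≤ R := Real.sqrt_nonneg _
  have hlogT : 0 ≤ Real.log T := Real.log_nonneg (by exact_mod_cast hT)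
  have hlogd : 0 ≤ Real.log M.det := log_det_designMatrix_nonneg z t
  have hscore' : matNorm M⁻¹ S ≤ 2 * σ * R := by
    refine hscore.trans ?_
    -- The level T⁴ contributes 8 log T = 4 · (2 log T), which the factor 2 in front of σ in the
    -- confidence radius absorbs.
    have : √(2 * Real.log ((T : ℝ) ^ 4) + Real.log M.det) ≤ 2 * R := by
      refine Real.sqrt_le_iff.2 ⟨by positivity, ?_⟩
      rw [Real.log_pow, mul_pow, hR, Real.sq_sqrt (by positivity)]
      push_cast
      linarith
    calc _ ≤ σ * (2 * R) := by gcongr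
      _ = _ := by ring
  have h₁ : inner ℝ S (θhat - θ) ≤ 2 * σ * R * X := by
    refine (le_abs_self _).trans ((abs_inner_le_matNorm_inv_mul hP _ _).trans ?_)
    rw [matNorm_sub_rev]
    gcongr
  have h₂ : 2 * glow * ‖θ‖ * ‖θ - θhat‖ ≤ 2 * glow * θbar * X := by
    have := hΘ θ hθ
    have := norm_le_matNorm_designMatrix z t (θ - θhat)
    gcongr
  have h₃ : X * (glow * X) ≤ X * (2 * σ * R + 2 * glow * θbar) := by nlinarith
  rcases hX0.eq_or_lt with h0 | h0
  · rw [← h0]; positivity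
  · have h₄ := le_of_mul_le_mul_left h₃ h0
    have : 2 * θbar + 2 * σ / glow * R = (2 * σ * R + 2 * glow * θbar) / glow := by
      field_simp; ring
    rw [this, le_div_iff₀ hglow]
    linarith

/-- A point whose objective is within `δ` of the maximum is close to the maximizer. -/
theorem matNorm_sub_le_of_gap (hΘconv : Convex ℝ Θ)
    (hgmono : StrictMono g) (hgdiff : Differentiable ℝ g) (hglow : 0 < glow)
    {z : ℕ → Param d} {D : ℕ → ℝ} {t : ℕ}
    (hm : ∀ τ ∈ Finset.Icc 1 t, ∀ θ₁ ∈ Θ, ∀ θ₂ ∈ Θ,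
      ∀ v ∈ Set.uIcc (inner ℝ (z τ) θ₂) (inner ℝ (z τ) θ₁), glow ≤ deriv g v)
    (hint : ∀ τ ∈ Finset.Icc 1 t, ∀ θ ∈ Θ,
      IntervalIntegrable (likIntegrand g (D τ)) volume (D τ) (g (inner ℝ (z τ) θ)))
    {θhat θ : Param d} (hhat : θhat ∈ Θ) (hmax : IsMaxOn (quasiObjective g 1 glow z D t) Θ θhat)
    (hθ : θ ∈ Θ) {δ : ℝ}
    (hgap : quasiObjective g 1 glow z D t θhat - quasiObjective g 1 glow z D t θ ≤ δ) :
    matNorm (designMatrix 1 z t) (θ - θhat) ≤ √(2 / glow * δ) := by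
  have h := quasiObjective_growth hgmono hgdiff hglow hΘconv hm hint hhat hmax hθ
  rw [← sq_matNorm_designMatrix] at h
  refine Real.le_sqrt_of_sq_le ?_
  rw [div_mul_eq_mul_div, le_div_iff₀ hglow]
  linarith

/-- Per-period loss of the algorithm on the event that the scores are small. -/
theorem IsApproxUCBRun.loss_le (hd : 1 ≤ d) {T : ℕ} (hT : 1 ≤ T)
    (hΘconv : Convex ℝ Θ) (hΘ : ∀ θ ∈ Θ, ‖θ‖ ≤ θbar) {θstar : Param d} (hθstar : θstar ∈ Θ)
    (hpstar : IsOptimalPricing g Θ 𝒳 pstar)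
    (hpint : ∀ θ ∈ Θ, ∀ x ∈ 𝒳, pstar θ x ∈ Set.Ioo plow phigh)
    (hz : ∀ x ∈ 𝒳, ∀ p ∈ Set.Icc plow phigh, ‖feature x p‖ ≤ 1)
    (hgmono : StrictMono g) (hgdiff : Differentiable ℝ g) (hglow : 0 < glow)
    (hg : ∀ x ∈ 𝒳, ∀ θ ∈ Θ, ∀ p ∈ Set.Icc plow phigh,
      glow ≤ deriv g (linPred θ x p) ∧ deriv g (linPred θ x p) ≤ ghigh)
    (hσ : 0 < σ) {x : ℕ → Covariate d} (hx : ∀ t ∈ Finset.Icc 1 T, x t ∈ 𝒳) {D Δ p : ℕ → ℝ}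
    {θhat θcheck θucb : ℕ → Param d}
    (hlik : ∀ t ∈ Finset.Icc 1 T, ∀ θ ∈ Θ, IntervalIntegrable (likIntegrand g (D t)) volume (D t)
      (g (inner ℝ (feature (x t) (p t)) θ)))
    (hrun : IsApproxUCBRun g Θ pstar 1 θbar σ glow T x D Δ θhat θcheck θucb p)
    (hscore : ∀ t ≤ T, matNorm (designMatrix 1 (fun τ => feature (x τ) (p τ)) t)⁻¹
        (∑ τ ∈ Finset.Icc 1 t, (D τ - g (inner ℝ (feature (x τ) (p τ)) θstar)) •
          feature (x τ) (p τ)) ≤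
      σ * √(2 * Real.log ((T : ℝ) ^ 4) +
        Real.log (designMatrix 1 (fun τ => feature (x τ) (p τ)) t).det))
    {t : ℕ} (ht : t ∈ Finset.Icc 1 T) :
    optRevenue g θstar (x t) - revenue g (p t) θstar (x t) ≤
      2 * phigh * ghigh * (alphaBar d θbar σ glow T + √2 / √glow * √(Δ (t - 1))) *
        matNorm (designMatrix 1 (fun τ => feature (x τ) (p τ)) (t - 1))⁻¹
          (feature (x t) (p t)) := by
  have htb := Finset.mem_Icc.1 ht
  have hsub : ∀ τ ∈ Finset.Icc 1 (t - 1), τ ∈ Finset.Icc 1 T := by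
    intro τ hτ
    simp only [Finset.mem_Icc] at hτ ⊢
    omega
  have hucb := hrun.ucb_mem
  have hp : ∀ τ ∈ Finset.Icc 1 T, p τ ∈ Set.Ioo plow phigh := fun τ hτ => by
    rw [hrun.price_eq τ hτ]
    exact hpint _ (hucb τ hτ).1 _ (hx τ hτ)
  have hzn : ∀ τ ∈ Finset.Icc 1 T, ‖feature (x τ) (p τ)‖ ≤ 1 := fun τ hτ =>
    hz _ (hx τ hτ) _ (Set.Ioo_subset_Icc_self (hp τ hτ))
  have hm : ∀ τ ∈ Finset.Icc 1 (t - 1), ∀ θ₁ ∈ Θ, ∀ θ₂ ∈ Θ,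
      ∀ v ∈ Set.uIcc (inner ℝ (feature (x τ) (p τ)) θ₂) (inner ℝ (feature (x τ) (p τ)) θ₁),
        glow ≤ deriv g v := fun τ hτ θ₁ h₁ θ₂ h₂ v hv =>
    (forall_uIcc_deriv_bounds hΘconv hg (hx τ (hsub τ hτ))
      (Set.Ioo_subset_Icc_self (hp τ (hsub τ hτ))) h₁ h₂ v hv).1
  have hint := fun τ hτ => hlik τ (hsub τ hτ)
  have hlt : t - 1 < T := by omega
  have c₁ := matNorm_sub_quasiMLE_le (z := fun τ => feature (x τ) (p τ)) hΘconv hΘ hgmono hgdiff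
    hglow hσ hT hm hint (hrun.hat_mem _ hlt) (hrun.hat_max _ hlt) hθstar (hscore _ hlt.le)
  have c₂ := matNorm_sub_le_of_gap (z := fun τ => feature (x τ) (p τ)) hΘconv hgmono hgdiff
    hglow hm hint (hrun.hat_mem _ hlt) (hrun.hat_max _ hlt) (hrun.check_mem _ hlt)
    (hrun.gap_le _ hlt)
  have c₃ := confRadius_le_alphaBar (θbar := θbar) hd hσ hglow hlt.le
    (z := fun τ => feature (x τ) (p τ)) (fun τ hτ => hzn τ (hsub τ hτ))
  have hmem := hucb t ht
  have hmaxu := hrun.ucb_max t ht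
  have hprice := hrun.price_eq t ht
  have hpt := hp t ht
  set M := designMatrix 1 (fun τ => feature (x τ) (p τ)) (t - 1) with hM
  have hP : M.PosDef := designMatrix_posDef _ _
  -- Triangle inequality through the exact maximizer: estimation error plus optimization error.
  have hmemstar : θstar ∈ confSet Θ 1 θbar σ glow T M (θcheck (t - 1)) (Δ (t - 1)) := by
    refine ⟨hθstar, ?_⟩
    have h := matNorm_add_le hP (θstar - θhat (t - 1)) (θhat (t - 1) - θcheck (t - 1))
    rw [sub_add_sub_cancel] at h
    rw [matNorm_sub_rev] at c₂
    linarith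
  have hopt : optRevenue g θstar (x t) ≤ optRevenue g (θucb t) (x t) := hmaxu hmemstar
  have hloss := optRevenue_sub_le_of_optimistic hΘconv hpstar hpint hgdiff hglow hg (hx t ht)
    hθstar hmem.1 hopt
  rw [← hprice] at hloss
  refine hloss.trans ?_
  have hp0 : 0 ≤ p t := by rw [hprice]; exact (hpstar _ hmem.1 _ (hx t ht)).1
  have hph : 0 ≤ phigh := hp0.trans hpt.2.le
  have hgb := hg _ (hx t ht) _ hθstar _ (Set.Ioo_subset_Icc_self hpt)
  have hgh : 0 ≤ ghigh := hglow.le.trans (hgb.1.trans hgb.2)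
  have hdist : matNorm M (θucb t - θstar) ≤
      2 * (alphaBar d θbar σ glow T + √2 / √glow * √(Δ (t - 1))) := by
    have h := matNorm_add_le hP (θucb t - θcheck (t - 1)) (θcheck (t - 1) - θstar)
    rw [sub_add_sub_cancel, matNorm_sub_rev M (θcheck (t - 1))] at h
    have h₁ := hmem.2
    have h₂ := hmemstar.2
    rw [sqrt_two_div_mul hglow] at h₁ h₂
    linarith
  have hin := abs_inner_le_matNorm_inv_mul hP (feature (x t) (p t)) (θucb t - θstar)
  have hzz := matNorm_nonneg M⁻¹ (feature (x t) (p t))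
  calc phigh * ghigh * |inner ℝ (feature (x t) (p t)) (θucb t - θstar)|
      ≤ phigh * ghigh * (matNorm M⁻¹ (feature (x t) (p t)) *
          (2 * (alphaBar d θbar σ glow T + √2 / √glow * √(Δ (t - 1))))) :=
        mul_le_mul_of_nonneg_left (hin.trans (mul_le_mul_of_nonneg_left hdist hzz))
          (mul_nonneg hph hgh)
    _ = _ := by ring

end Pricing

/-! ### Measurability, integrability and removal of the noise. -/

section Expectation

variable {d : ℕ} {g : ℝ → ℝ} {Θ : Set (Param d)} {𝒳 : Set (Covariate d)}
  {pstar : Param d → Covariate d → ℝ} {θbar plow phigh : ℝ}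
  {Ω : Type*} {m : MeasurableSpace Ω}

/-- The optimal revenue is a supremum over countably many prices. -/
theorem IsOptimalPricing.optRevenue_eq_iSup (hpstar : IsOptimalPricing g Θ 𝒳 pstar)
    (hgc : Continuous g) {θ : Param d} (hθ : θ ∈ Θ) {x : Covariate d} (hx : x ∈ 𝒳) :
    optRevenue g θ x =
      ⨆ k : ℕ, revenue g (TopologicalSpace.denseSeq (Set.Ici (0 : ℝ)) k) θ x := by
  have hgr := hpstar.isGreatest hθ hx
  have hbdd : BddAbove (Set.range fun k : ℕ =>
      revenue g (TopologicalSpace.denseSeq (Set.Ici (0 : ℝ)) k) θ x) := by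
    refine ⟨revenue g (pstar θ x) θ x, ?_⟩
    rintro _ ⟨k, rfl⟩
    exact hgr.2 ⟨_, (TopologicalSpace.denseSeq (Set.Ici (0 : ℝ)) k).2, rfl⟩
  apply le_antisymm
  · rw [hpstar.optRevenue_eq hθ hx]
    have hcont : Continuous fun p : Set.Ici (0 : ℝ) => revenue g p θ x := by
      unfold revenue linPred
      fun_prop
    exact (TopologicalSpace.denseRange_denseSeq (Set.Ici (0 : ℝ))).induction_on
      (p := fun p => revenue g p θ x ≤
        ⨆ k : ℕ, revenue g (TopologicalSpace.denseSeq (Set.Ici (0 : ℝ)) k) θ x)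
      ⟨pstar θ x, (hpstar θ hθ x hx).1⟩ (isClosed_le hcont continuous_const)
      fun k => le_ciSup hbdd k
  · rw [hpstar.optRevenue_eq hθ hx]
    exact ciSup_le fun k => hgr.2 ⟨_, (TopologicalSpace.denseSeq (Set.Ici (0 : ℝ)) k).2, rfl⟩

theorem measurable_link_linPred (hgc : Continuous g) (θ : Param d) {x : Ω → Covariate d}
    (hx : Measurable x) {p : Ω → ℝ} (hp : Measurable p) :
    Measurable fun ω => g (linPred θ (x ω) (p ω)) := by
  refine hgc.measurable.comp ?_
  unfold linPred
  fun_prop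

theorem measurable_feature {x : Ω → Covariate d} (hx : Measurable x) {p : Ω → ℝ}
    (hp : Measurable p) : Measurable fun ω => feature (x ω) (p ω) := by
  refine (WithLp.measurable_toLp 2 (Fin d ⊕ Fin d → ℝ)).comp (measurable_pi_iff.2 ?_)
  rintro (i | i)
  · simp only [Sum.elim_inl]; fun_prop
  · simp only [Sum.elim_inr]; fun_prop

theorem IsOptimalPricing.measurable_optRevenue (hpstar : IsOptimalPricing g Θ 𝒳 pstar)
    (hgc : Continuous g) {θ : Param d} (hθ : θ ∈ Θ) {x : Ω → Covariate d} (hx : Measurable x)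
    (hx𝒳 : ∀ ω, x ω ∈ 𝒳) : Measurable fun ω => optRevenue g θ (x ω) := by
  simp only [hpstar.optRevenue_eq_iSup hgc hθ (hx𝒳 _)]
  exact Measurable.iSup fun k =>
    measurable_const.mul (measurable_link_linPred hgc θ hx measurable_const)

theorem abs_link_le (hgmono : StrictMono g) (hΘ : ∀ θ ∈ Θ, ‖θ‖ ≤ θbar)
    (hz : ∀ x ∈ 𝒳, ∀ p ∈ Set.Icc plow phigh, ‖feature x p‖ ≤ 1) {θ : Param d} (hθ : θ ∈ Θ)
    {x : Covariate d} (hx : x ∈ 𝒳) {p : ℝ} (hp : p ∈ Set.Icc plow phigh) :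
    |g (linPred θ x p)| ≤ |g (-θbar)| + |g θbar| := by
  have h : |linPred θ x p| ≤ θbar := by
    rw [← inner_feature]
    calc |inner ℝ (feature x p) θ| ≤ ‖feature x p‖ * ‖θ‖ := abs_real_inner_le_norm _ _
      _ ≤ 1 * θbar := mul_le_mul (hz x hx p hp) (hΘ θ hθ) (norm_nonneg _) zero_le_one
      _ = θbar := one_mul _
  rw [abs_le] at h
  have h₁ := hgmono.monotone h.1
  have h₂ := hgmono.monotone h.2
  rw [abs_le]
  constructor
  · linarith [neg_abs_le (g (-θbar)), abs_nonneg (g θbar)]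
  · linarith [le_abs_self (g θbar), abs_nonneg (g (-θbar))]

theorem IsOptimalPricing.integrable_optRevenue {P : Measure Ω} [IsFiniteMeasure P]
    (hpstar : IsOptimalPricing g Θ 𝒳 pstar)
    (hpint : ∀ θ ∈ Θ, ∀ x ∈ 𝒳, pstar θ x ∈ Set.Ioo plow phigh)
    (hgmono : StrictMono g) (hgc : Continuous g) (hΘ : ∀ θ ∈ Θ, ‖θ‖ ≤ θbar)
    (hz : ∀ x ∈ 𝒳, ∀ p ∈ Set.Icc plow phigh, ‖feature x p‖ ≤ 1) {θ : Param d} (hθ : θ ∈ Θ)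
    {x : Ω → Covariate d} (hx : Measurable x) (hx𝒳 : ∀ ω, x ω ∈ 𝒳) :
    Integrable (fun ω => optRevenue g θ (x ω)) P := by
  refine Integrable.of_bound (hpstar.measurable_optRevenue hgc hθ hx hx𝒳).aestronglyMeasurable
    (phigh * (|g (-θbar)| + |g θbar|)) (Filter.Eventually.of_forall fun ω => ?_)
  have hp := hpint θ hθ _ (hx𝒳 ω)
  have hp0 := (hpstar θ hθ _ (hx𝒳 ω)).1
  rw [hpstar.optRevenue_eq hθ (hx𝒳 ω), revenue, Real.norm_eq_abs, abs_mul, abs_of_nonneg hp0]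
  exact mul_le_mul hp.2.le (abs_link_le hgmono hΘ hz hθ (hx𝒳 ω) (Set.Ioo_subset_Icc_self hp))
    (abs_nonneg _) (hp0.trans hp.2.le)

theorem IsSubGaussianMDS.integrable {P : Measure Ω} {ℱ : Filtration ℕ m} {ε : ℕ → Ω → ℝ}
    {σ : ℝ} {T : ℕ} (hε : IsSubGaussianMDS P ℱ ε σ T) {t : ℕ} (ht : t ∈ Finset.Icc 1 T) :
    Integrable (ε t) P := by
  refine ((hε.integrable_exp t ht 1).add (hε.integrable_exp t ht (-1))).mono'
    ((hε.meas t ht).mono (ℱ.le t) le_rfl).aestronglyMeasurable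
    (Filter.Eventually.of_forall fun ω => ?_)
  simp only [Pi.add_apply, one_mul, neg_one_mul, Real.norm_eq_abs]
  rw [abs_le]
  constructor
  · linarith [Real.add_one_le_exp (-ε t ω), Real.exp_pos (ε t ω)]
  · linarith [Real.add_one_le_exp (ε t ω), Real.exp_pos (-ε t ω)]

theorem IsSubGaussianMDS.integrable_mul {P : Measure Ω} {ℱ : Filtration ℕ m} {ε : ℕ → Ω → ℝ}
    {σ : ℝ} {T : ℕ} (hε : IsSubGaussianMDS P ℱ ε σ T) {t : ℕ} (ht : t ∈ Finset.Icc 1 T)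
    {p : Ω → ℝ} (hp : Measurable[ℱ (t - 1)] p) {C : ℝ} (hC : ∀ᵐ ω ∂P, |p ω| ≤ C) :
    Integrable (fun ω => p ω * ε t ω) P :=
  (hε.integrable ht).bdd_mul (hp.mono (ℱ.le _) le_rfl).aestronglyMeasurable hC

theorem IsSubGaussianMDS.integral_mul_eq_zero {P : Measure Ω} [IsFiniteMeasure P]
    {ℱ : Filtration ℕ m} {ε : ℕ → Ω → ℝ}
    {σ : ℝ} {T : ℕ} (hε : IsSubGaussianMDS P ℱ ε σ T) {t : ℕ} (ht : t ∈ Finset.Icc 1 T)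
    {p : Ω → ℝ} (hp : Measurable[ℱ (t - 1)] p) {C : ℝ} (hC : ∀ᵐ ω ∂P, |p ω| ≤ C) :
    ∫ ω, p ω * ε t ω ∂P = 0 := by
  have h := condExp_mul_of_stronglyMeasurable_left (m := ℱ (t - 1)) hp.stronglyMeasurable
    (hε.integrable_mul ht hp hC) (hε.integrable ht)
  have h' : ∫ ω, (p * ε t) ω ∂P = 0 := by
    rw [← integral_condExp (ℱ.le (t - 1))]
    refine integral_eq_zero_of_ae ?_
    filter_upwards [h, hε.condExp_eq_zero t ht] with ω h₁ h₂
    rw [h₁, Pi.mul_apply, h₂, Pi.zero_apply, mul_zero]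
  exact h'

/-- The noise does not contribute to the regret. -/
theorem regret_eq_integral_sum_loss {P : Measure Ω} [IsProbabilityMeasure P]
    {ℱ : Filtration ℕ m} {ε : ℕ → Ω → ℝ} {σ : ℝ} {T : ℕ} (hε : IsSubGaussianMDS P ℱ ε σ T)
    (hpstar : IsOptimalPricing g Θ 𝒳 pstar)
    (hpint : ∀ θ ∈ Θ, ∀ x ∈ 𝒳, pstar θ x ∈ Set.Ioo plow phigh)
    (hgmono : StrictMono g) (hgc : Continuous g) (hΘ : ∀ θ ∈ Θ, ‖θ‖ ≤ θbar)
    (hz : ∀ x ∈ 𝒳, ∀ p ∈ Set.Icc plow phigh, ‖feature x p‖ ≤ 1) {θ : Param d} (hθ : θ ∈ Θ)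
    {x : ℕ → Ω → Covariate d} (hx : ∀ t ∈ Finset.Icc 1 T, ∀ ω, x t ω ∈ 𝒳)
    (hxmeas : ∀ t ∈ Finset.Icc 1 T, Measurable[ℱ (t - 1)] (x t))
    {p : ℕ → Ω → ℝ} (hpmeas : ∀ t ∈ Finset.Icc 1 T, Measurable[ℱ (t - 1)] (p t))
    (hp : ∀ᵐ ω ∂P, ∀ t ∈ Finset.Icc 1 T, 0 ≤ p t ω ∧ p t ω ∈ Set.Icc plow phigh) :
    Integrable (fun ω => ∑ t ∈ Finset.Icc 1 T,
        (optRevenue g θ (x t ω) - revenue g (p t ω) θ (x t ω))) P ∧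
      regret P g θ T x p ε = ∫ ω, ∑ t ∈ Finset.Icc 1 T,
        (optRevenue g θ (x t ω) - revenue g (p t ω) θ (x t ω)) ∂P := by
  have hpC : ∀ t ∈ Finset.Icc 1 T, ∀ᵐ ω ∂P, |p t ω| ≤ phigh := by
    intro t ht
    filter_upwards [hp] with ω hω
    rw [abs_of_nonneg (hω t ht).1]
    exact (hω t ht).2.2
  have i₁ : ∀ t ∈ Finset.Icc 1 T, Integrable (fun ω => optRevenue g θ (x t ω)) P := fun t ht =>
    hpstar.integrable_optRevenue hpint hgmono hgc hΘ hz hθ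
      ((hxmeas t ht).mono (ℱ.le _) le_rfl) (hx t ht)
  have i₂ : ∀ t ∈ Finset.Icc 1 T, Integrable (fun ω => revenue g (p t ω) θ (x t ω)) P := by
    intro t ht
    have hxm := (hxmeas t ht).mono (ℱ.le _) le_rfl
    have hpm := (hpmeas t ht).mono (ℱ.le _) le_rfl
    refine Integrable.of_bound
      (hpm.mul (measurable_link_linPred hgc θ hxm hpm)).aestronglyMeasurable
      (phigh * (|g (-θbar)| + |g θbar|)) ?_
    filter_upwards [hp, hpC t ht] with ω hω hC
    rw [revenue, Real.norm_eq_abs, abs_mul]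
    exact mul_le_mul hC (abs_link_le hgmono hΘ hz hθ (hx t ht ω) (hω t ht).2) (abs_nonneg _)
      ((abs_nonneg _).trans hC)
  have i₃ : ∀ t ∈ Finset.Icc 1 T, Integrable (fun ω => p t ω * ε t ω) P := fun t ht =>
    hε.integrable_mul ht (hpmeas t ht) (hpC t ht)
  have i₄ : ∀ t ∈ Finset.Icc 1 T,
      Integrable (fun ω => revenue g (p t ω) θ (x t ω) + p t ω * ε t ω) P := fun t ht =>
    (i₂ t ht).add (i₃ t ht)
  have i₅ : ∀ t ∈ Finset.Icc 1 T, Integrable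
      (fun ω => optRevenue g θ (x t ω) - revenue g (p t ω) θ (x t ω)) P := fun t ht =>
    (i₁ t ht).sub (i₂ t ht)
  refine ⟨integrable_finsetSum _ i₅, ?_⟩
  have hdem : ∀ t ω, p t ω * demand g θ (x t ω) (p t ω) (ε t ω) =
      revenue g (p t ω) θ (x t ω) + p t ω * ε t ω := fun t ω => by
    rw [demand, revenue, mul_add]
  simp only [regret, hdem]
  rw [integral_finsetSum _ i₁, integral_finsetSum _ i₄,
    integral_finsetSum _ i₅, ← Finset.sum_sub_distrib]
  refine Finset.sum_congr rfl fun t ht => ?_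
  rw [integral_sub (i₁ t ht) (i₂ t ht), integral_add (i₂ t ht) (i₃ t ht),
    hε.integral_mul_eq_zero ht (hpmeas t ht) (hpC t ht), add_zero]

end Expectation

section Numerics

theorem two_mul_div_le_mul_log {d : ℕ} (hd : 1 ≤ d) (T : ℕ) :
    2 * (T : ℝ) / (T + 4) ≤ d * Real.log ((2 * d + T) / (2 * d)) := by
  have hd' : (1 : ℝ) ≤ d := by exact_mod_cast hd
  have hT : (0 : ℝ) ≤ T := Nat.cast_nonneg T
  have h := Real.le_log_one_add_of_nonneg (x := T / (2 * d)) (by positivity)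
  have e : 1 + (T : ℝ) / (2 * d) = (2 * d + T) / (2 * d) := by field_simp
  rw [e] at h
  refine le_trans ?_ (mul_le_mul_of_nonneg_left h (by linarith))
  have e' : (d : ℝ) * (2 * (T / (2 * d)) / (T / (2 * d) + 2)) = 2 * d * T / (T + 4 * d) := by
    field_simp
    ring
  rw [e', div_le_div_iff₀ (by positivity) (by positivity)]
  nlinarith [mul_nonneg (sq_nonneg (T : ℝ)) (sub_nonneg.2 hd')]

theorem one_le_two_mul_sqrt {d : ℕ} (hd : 1 ≤ d) {T : ℕ} (hT : 1 ≤ T) :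
    1 ≤ 2 * √(T * d * Real.log ((2 * d + T) / (2 * d))) := by
  have h := two_mul_div_le_mul_log hd T
  have hT' : (1 : ℝ) ≤ T := by exact_mod_cast hT
  have h₁ : (1 / 4 : ℝ) ≤ 2 * (T : ℝ) / (T + 4) := by
    rw [div_le_div_iff₀ (by norm_num) (by positivity)]; linarith
  have h₂ : (1 / 2 : ℝ) ≤ √(T * d * Real.log ((2 * d + T) / (2 * d))) := by
    refine Real.le_sqrt_of_sq_le ?_
    rw [mul_assoc]
    nlinarith
  linarith

/-- The failure event costs less than the slack of the elliptic potential bound. -/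
theorem mul_inv_pow_le_slack {d : ℕ} (hd : 1 ≤ d) {T : ℕ} (hT : 2 ≤ T) :
    (T : ℝ) * ((T : ℝ) ^ 4)⁻¹ ≤
      (2 - √3) * √(T * d * Real.log ((2 * d + T) / (2 * d))) := by
  have h := two_mul_div_le_mul_log hd T
  have hT' : (2 : ℝ) ≤ T := by exact_mod_cast hT
  have h₁ : (2 / 3 : ℝ) ≤ 2 * (T : ℝ) / (T + 4) := by
    rw [div_le_div_iff₀ (by norm_num) (by positivity)]; linarith
  have h₂ : (1 : ℝ) ≤ √(T * d * Real.log ((2 * d + T) / (2 * d))) := by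
    refine Real.le_sqrt_of_sq_le ?_
    rw [mul_assoc]
    nlinarith
  have h₃ : √3 ≤ 7 / 4 := Real.sqrt_le_iff.2 ⟨by norm_num, by norm_num⟩
  have h₄ : (T : ℝ) * ((T : ℝ) ^ 4)⁻¹ ≤ 1 / 8 := by
    have : (T : ℝ) * ((T : ℝ) ^ 4)⁻¹ = 1 / (T : ℝ) ^ 3 := by field_simp
    rw [this]
    refine one_div_le_one_div_of_le (by norm_num) ?_
    calc (8 : ℝ) = 2 ^ 3 := by norm_num
      _ ≤ (T : ℝ) ^ 3 := by gcongr
  nlinarith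

end Numerics

/-- Regret bound for UCB pricing with approximation in terms of an integrable bound `R` on the
contribution of the optimality gaps. -/
theorem regret_le_of_gap_contribution_le {d : ℕ} (hd : 1 ≤ d) {T : ℕ} (hT : 1 ≤ T)
    -- the model
    (g : ℝ → ℝ) (θstar : Param d) (Θ : Set (Param d)) (𝒳 : Set (Covariate d))
    (pstar : Param d → Covariate d → ℝ) (θbar plow phigh glow ghigh σ : ℝ)
    -- boundedness
    (hθbar : 0 < θbar) (hΘconv : Convex ℝ Θ) (hΘ : ∀ θ ∈ Θ, ‖θ‖ ≤ θbar) (hθstar : θstar ∈ Θ)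
    (hpstar : IsOptimalPricing g Θ 𝒳 pstar)
    (hpint : ∀ θ ∈ Θ, ∀ x ∈ 𝒳, pstar θ x ∈ Set.Ioo plow phigh)
    (hz : ∀ x ∈ 𝒳, ∀ p ∈ Set.Icc plow phigh, ‖feature x p‖ ≤ 1)
    -- properties of the link function
    (hgmono : StrictMono g) (hgdiff : Differentiable ℝ g) (hglow : 0 < glow)
    (hg : ∀ x ∈ 𝒳, ∀ θ ∈ Θ, ∀ p ∈ Set.Icc plow phigh,
      glow ≤ deriv g (linPred θ x p) ∧ deriv g (linPred θ x p) ≤ ghigh)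
    -- probability space, demand shocks, covariates, non-anticipating prices
    {Ω : Type*} {m : MeasurableSpace Ω} (P : Measure Ω) [IsProbabilityMeasure P]
    (ℱ : Filtration ℕ m) (ε : ℕ → Ω → ℝ) (hσ : 0 < σ) (hε : IsSubGaussianMDS P ℱ ε σ T)
    (x : ℕ → Ω → Covariate d) (hx : ∀ t ∈ Finset.Icc 1 T, ∀ ω, x t ω ∈ 𝒳)
    (hxmeas : ∀ t ∈ Finset.Icc 1 T, Measurable[ℱ (t - 1)] (x t))
    (p : ℕ → Ω → ℝ) (hpmeas : ∀ t ∈ Finset.Icc 1 T, Measurable[ℱ (t - 1)] (p t))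
    -- the integrals that define the likelihoods converge
    (hlik : ∀ᵐ ω ∂P, ∀ t ∈ Finset.Icc 1 T, ∀ θ ∈ Θ,
      IntervalIntegrable
        (likIntegrand g (demand g θstar (x t ω) (p t ω) (ε t ω))) volume
        (demand g θstar (x t ω) (p t ω) (ε t ω)) (g (inner ℝ (feature (x t ω) (p t ω)) θ)))
    -- prices are set by UCB pricing with approximation, with regularization parameter 1
    (Δ : ℕ → Ω → ℝ) (θhat θcheck θucb : ℕ → Ω → Param d)
    (hrun : ∀ᵐ ω ∂P, IsApproxUCBRun g Θ pstar 1 θbar σ glow T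
      (fun t => x t ω) (fun t => demand g θstar (x t ω) (p t ω) (ε t ω)) (fun t => Δ t ω)
      (fun t => θhat t ω) (fun t => θcheck t ω) (fun t => θucb t ω) (fun t => p t ω))
    {R : Ω → ℝ} (hR : Integrable R P)
    (hgap : ∀ᵐ ω ∂P, ∑ t ∈ Finset.Icc 1 T, √(Δ (t - 1) ω) *
      matNorm (designMatrix 1 (fun τ => feature (x τ ω) (p τ ω)) (t - 1))⁻¹
        (feature (x t ω) (p t ω)) ≤ R ω) :
    0 < phigh ∧ regret P g θstar T x p ε ≤
      4 * phigh * ghigh *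
        (alphaBar d θbar σ glow T * √(T * d * Real.log ((2 * d + T) / (2 * d))) +
          √2 / (2 * √glow) * ∫ ω, R ω ∂P) := by
  have h1T : 1 ∈ Finset.Icc 1 T := Finset.mem_Icc.2 ⟨le_rfl, hT⟩
  obtain ⟨ω₀⟩ : Nonempty Ω := P.nonempty_of_neZero
  have hp₀ := hpint θstar hθstar _ (hx 1 h1T ω₀)
  have hph : 0 < phigh := (hpstar θstar hθstar _ (hx 1 h1T ω₀)).1.trans_lt hp₀.2
  have hg₀ := hg _ (hx 1 h1T ω₀) θstar hθstar _ (Set.Ioo_subset_Icc_self hp₀)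
  have hgh : 0 < ghigh := hglow.trans_le (hg₀.1.trans hg₀.2)
  refine ⟨hph, ?_⟩
  have hpbd : ∀ᵐ ω ∂P, ∀ t ∈ Finset.Icc 1 T, 0 ≤ p t ω ∧ p t ω ∈ Set.Icc plow phigh := by
    filter_upwards [hrun] with ω hω t ht
    rw [hω.price_eq t ht]
    exact ⟨(hpstar _ (hω.ucb_mem t ht).1 _ (hx t ht ω)).1,
      Set.Ioo_subset_Icc_self (hpint _ (hω.ucb_mem t ht).1 _ (hx t ht ω))⟩
  obtain ⟨hGint, hreg⟩ := regret_eq_integral_sum_loss hε hpstar hpint hgmono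
    hgdiff.continuous hΘ hz hθstar hx hxmeas hpmeas hpbd
  rw [hreg]
  set G : Ω → ℝ := fun ω => ∑ t ∈ Finset.Icc 1 T,
    (optRevenue g θstar (x t ω) - revenue g (p t ω) θstar (x t ω)) with hGdef
  set K := √(T * d * Real.log ((2 * d + T) / (2 * d))) with hK
  set A := alphaBar d θbar σ glow T with hA
  have hA2 : 2 * θbar ≤ A := by
    rw [hA, alphaBar]
    exact le_add_of_nonneg_right (by positivity)
  have hK0 : 0 ≤ K := Real.sqrt_nonneg _
  have hA0 : 0 ≤ A := le_trans (by positivity) hA2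
  have hzmeas : ∀ t ∈ Finset.Icc 1 T,
      Measurable[ℱ (t - 1)] fun ω => feature (x t ω) (p t ω) := fun t ht =>
    measurable_feature (hxmeas t ht) (hpmeas t ht)
  have hTpos : (0 : ℝ) < T := by exact_mod_cast hT
  obtain ⟨B, hBmeas, hPB, hBscore⟩ := exists_measurable_self_normalized_bound hσ hε hzmeas
    (c := (T : ℝ) ^ 4) (by positivity)
  have hcrude : ∀ᵐ ω ∂P, G ω ≤ T * (4 * phigh * ghigh * θbar) := by
    filter_upwards [hrun] with ω hω
    calc G ω ≤ ∑ t ∈ Finset.Icc 1 T, 4 * phigh * ghigh * θbar := by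
          refine Finset.sum_le_sum fun t ht => ?_
          rw [hω.price_eq t ht]
          exact optRevenue_sub_le hΘconv hΘ hpstar hpint hz hgdiff hglow hg (hx t ht ω) hθstar
            (hω.ucb_mem t ht).1
      _ = _ := by simp
  have hR0 : ∀ᵐ ω ∂P, 0 ≤ R ω := by
    filter_upwards [hgap] with ω hω
    exact (Finset.sum_nonneg fun t _ =>
      mul_nonneg (Real.sqrt_nonneg _) (matNorm_nonneg _ _)).trans hω
  have hgood : ∀ᵐ ω ∂P, ω ∉ B →
      G ω ≤ 2 * phigh * ghigh * (A * (√3 * K) + √2 / √glow * R ω) := by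
    filter_upwards [hrun, hlik, hgap, hpbd] with ω hω hl hgω hpω hωB
    have hscore := hBscore ω hωB
    have hsum : ∑ t ∈ Finset.Icc 1 T,
        matNorm (designMatrix 1 (fun τ => feature (x τ ω) (p τ ω)) (t - 1))⁻¹
          (feature (x t ω) (p t ω)) ≤ √3 * K :=
      sum_matNorm_inv_le (z := fun τ => feature (x τ ω) (p τ ω)) hd
        fun τ hτ => hz _ (hx τ hτ ω) _ (hpω τ hτ).2
    calc G ω ≤ ∑ t ∈ Finset.Icc 1 T, 2 * phigh * ghigh * (A + √2 / √glow * √(Δ (t - 1) ω)) *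
          matNorm (designMatrix 1 (fun τ => feature (x τ ω) (p τ ω)) (t - 1))⁻¹
            (feature (x t ω) (p t ω)) := by
          refine Finset.sum_le_sum fun t ht => ?_
          refine hω.loss_le hd hT hΘconv hΘ hθstar hpstar hpint hz hgmono hgdiff hglow hg hσ
            (fun t ht => hx t ht ω) hl ?_ ht
          simpa only [demand, inner_feature, add_sub_cancel_left] using hscore
      _ = 2 * phigh * ghigh * (A * ∑ t ∈ Finset.Icc 1 T,
            matNorm (designMatrix 1 (fun τ => feature (x τ ω) (p τ ω)) (t - 1))⁻¹
              (feature (x t ω) (p t ω)) +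
            √2 / √glow * ∑ t ∈ Finset.Icc 1 T, √(Δ (t - 1) ω) *
              matNorm (designMatrix 1 (fun τ => feature (x τ ω) (p τ ω)) (t - 1))⁻¹
                (feature (x t ω) (p t ω))) := by
          rw [Finset.mul_sum, Finset.mul_sum, ← Finset.sum_add_distrib, Finset.mul_sum]
          exact Finset.sum_congr rfl fun t _ => by ring
      _ ≤ _ := by gcongr
  have hIR : 0 ≤ ∫ ω, R ω ∂P := integral_nonneg_of_ae hR0
  have hfactor : 4 * phigh * ghigh * (A * K + √2 / (2 * √glow) * ∫ ω, R ω ∂P) =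
      2 * phigh * ghigh * (A * (2 * K) + √2 / √glow * ∫ ω, R ω ∂P) := by
    field_simp
    ring
  rw [hfactor]
  rcases hT.eq_or_lt with h1 | h2
  · have hK1 : 1 ≤ 2 * K := one_le_two_mul_sqrt hd hT
    calc ∫ ω, G ω ∂P ≤ ∫ _, T * (4 * phigh * ghigh * θbar) ∂P :=
          integral_mono_ae hGint (integrable_const _) hcrude
      _ = 2 * phigh * ghigh * (2 * θbar * 1) := by
          rw [integral_const, ← h1]; simp; ring
      _ ≤ 2 * phigh * ghigh * (A * (2 * K)) := by gcongr
      _ ≤ _ := by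
          gcongr
          exact le_add_of_nonneg_right (by positivity)
  · have hBreal : P.real B ≤ ((T : ℝ) ^ 4)⁻¹ :=
      ENNReal.toReal_le_of_le_ofReal (by positivity) hPB
    have hi₁ : Integrable (fun ω =>
        2 * phigh * ghigh * (A * (√3 * K) + √2 / √glow * R ω)) P :=
      ((integrable_const _).add (hR.const_mul _)).const_mul _
    have hi₂ : Integrable (B.indicator fun _ => T * (4 * phigh * ghigh * θbar)) P :=
      (integrable_const _).indicator hBmeas
    have hslack := mul_inv_pow_le_slack hd h2
    calc ∫ ω, G ω ∂P ≤ ∫ ω, (2 * phigh * ghigh * (A * (√3 * K) + √2 / √glow * R ω) +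
          B.indicator (fun _ => T * (4 * phigh * ghigh * θbar)) ω) ∂P := by
          refine integral_mono_ae hGint (hi₁.add hi₂) ?_
          filter_upwards [hcrude, hR0, hgood] with ω h₁ h₂ h₃
          by_cases hω : ω ∈ B
          · rw [Set.indicator_of_mem hω]
            exact h₁.trans (le_add_of_nonneg_left (by positivity))
          · rw [Set.indicator_of_notMem hω, add_zero]
            exact h₃ hω
      _ = 2 * phigh * ghigh * (A * (√3 * K) + √2 / √glow * ∫ ω, R ω ∂P) +
          P.real B * (T * (4 * phigh * ghigh * θbar)) := by
          rw [integral_add hi₁ hi₂, integral_indicator_const _ hBmeas, integral_const_mul,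
            integral_add (integrable_const _) (hR.const_mul _), integral_const_mul (√2 / √glow)]
          simp
      _ ≤ 2 * phigh * ghigh * (A * (√3 * K) + √2 / √glow * ∫ ω, R ω ∂P) +
          ((T : ℝ) ^ 4)⁻¹ * (T * (4 * phigh * ghigh * θbar)) := by gcongr
      _ = 2 * phigh * ghigh * (A * (√3 * K) + √2 / √glow * (∫ ω, R ω ∂P) +
          2 * θbar * (T * ((T : ℝ) ^ 4)⁻¹)) := by ring
      _ ≤ 2 * phigh * ghigh * (A * (√3 * K) + √2 / √glow * (∫ ω, R ω ∂P) +
          A * ((2 - √3) * K)) := by gcongr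
      _ = _ := by ring

theorem mainTheorem4 {d : ℕ} (hd : 1 ≤ d) {T : ℕ} (hT : 1 ≤ T)
    -- the model
    (g : ℝ → ℝ) (θstar : Param d) (Θ : Set (Param d)) (𝒳 : Set (Covariate d))
    (pstar : Param d → Covariate d → ℝ) (θbar plow phigh glow ghigh σ : ℝ)
    -- boundedness
    (hθbar : 0 < θbar) (hΘconv : Convex ℝ Θ) (hΘ : ∀ θ ∈ Θ, ‖θ‖ ≤ θbar) (hθstar : θstar ∈ Θ)
    (hpstar : IsOptimalPricing g Θ 𝒳 pstar)
    (hpint : ∀ θ ∈ Θ, ∀ x ∈ 𝒳, pstar θ x ∈ Set.Ioo plow phigh)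
    (hz : ∀ x ∈ 𝒳, ∀ p ∈ Set.Icc plow phigh, ‖feature x p‖ ≤ 1)
    -- properties of the link function
    (hgmono : StrictMono g) (hgdiff : Differentiable ℝ g) (hglow : 0 < glow)
    (hg : ∀ x ∈ 𝒳, ∀ θ ∈ Θ, ∀ p ∈ Set.Icc plow phigh,
      glow ≤ deriv g (linPred θ x p) ∧ deriv g (linPred θ x p) ≤ ghigh)
    -- probability space, demand shocks, covariates, non-anticipating prices
    {Ω : Type*} {m : MeasurableSpace Ω} (P : Measure Ω) [IsProbabilityMeasure P]
    (ℱ : Filtration ℕ m) (ε : ℕ → Ω → ℝ) (hσ : 0 < σ) (hε : IsSubGaussianMDS P ℱ ε σ T)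
    (x : ℕ → Ω → Covariate d) (hx : ∀ t ∈ Finset.Icc 1 T, ∀ ω, x t ω ∈ 𝒳)
    (hxmeas : ∀ t ∈ Finset.Icc 1 T, Measurable[ℱ (t - 1)] (x t))
    (p : ℕ → Ω → ℝ) (hpmeas : ∀ t ∈ Finset.Icc 1 T, Measurable[ℱ (t - 1)] (p t))
    -- the integrals that define the likelihoods converge
    (hlik : ∀ᵐ ω ∂P, ∀ t ∈ Finset.Icc 1 T, ∀ θ ∈ Θ,
      IntervalIntegrable
        (likIntegrand g (demand g θstar (x t ω) (p t ω) (ε t ω))) volume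
        (demand g θstar (x t ω) (p t ω) (ε t ω)) (g (inner ℝ (feature (x t ω) (p t ω)) θ)))
    -- prices are set by UCB pricing with approximation, with regularization parameter 1
    (Δ : ℕ → Ω → ℝ) (θhat θcheck θucb : ℕ → Ω → Param d)
    (hrun : ∀ᵐ ω ∂P, IsApproxUCBRun g Θ pstar 1 θbar σ glow T
      (fun t => x t ω) (fun t => demand g θstar (x t ω) (p t ω) (ε t ω)) (fun t => Δ t ω)
      (fun t => θhat t ω) (fun t => θcheck t ω) (fun t => θucb t ω) (fun t => p t ω)) :
    ((∀ t ∈ Finset.Icc 1 T, Integrable (fun ω => √(Δ (t - 1) ω) *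
        matNorm (designMatrix 1 (fun τ => feature (x τ ω) (p τ ω)) (t - 1))⁻¹
          (feature (x t ω) (p t ω))) P) →
      regret P g θstar T x p ε ≤
        4 * phigh * ghigh *
          (alphaBar d θbar σ glow T * √(T * d * Real.log ((2 * d + T) / (2 * d))) +
            √2 / (2 * √glow) * ∑ t ∈ Finset.Icc 1 T, ∫ ω, √(Δ (t - 1) ω) *
              matNorm (designMatrix 1 (fun τ => feature (x τ ω) (p τ ω)) (t - 1))⁻¹
                (feature (x t ω) (p t ω)) ∂P) + phigh) ∧
    (∀ Δbar : ℝ, (∀ᵐ ω ∂P, ∀ t ∈ Finset.Icc 1 T, Δ (t - 1) ω ≤ Δbar) →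
      regret P g θstar T x p ε ≤
        4 * phigh * ghigh * (alphaBar d θbar σ glow T + √(2 * Δbar / glow)) *
          √(T * d * Real.log ((2 * d + T) / (2 * d))) + phigh) := by
  constructor
  · intro hint
    obtain ⟨hph, h⟩ := regret_le_of_gap_contribution_le hd hT g θstar Θ 𝒳 pstar θbar plow phigh glow ghigh σ hθbar hΘconv hΘ hθstar hpstar
      hpint hz hgmono hgdiff hglow hg P ℱ ε hσ hε x hx hxmeas p hpmeas hlik Δ θhat θcheck θucb hrun
      (integrable_finsetSum _ hint) (Filter.Eventually.of_forall fun ω => le_rfl)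
    rw [integral_finsetSum _ hint] at h
    linarith
  · intro Δbar hΔ
    have hgap : ∀ᵐ ω ∂P, ∑ t ∈ Finset.Icc 1 T, √(Δ (t - 1) ω) *
        matNorm (designMatrix 1 (fun τ => feature (x τ ω) (p τ ω)) (t - 1))⁻¹
          (feature (x t ω) (p t ω)) ≤
        √Δbar * (2 * √(T * d * Real.log ((2 * d + T) / (2 * d)))) := by
      filter_upwards [hΔ, hrun] with ω hω hr
      have hsum := sum_matNorm_inv_le (z := fun τ => feature (x τ ω) (p τ ω)) (T := T) hd
        fun τ hτ => hz _ (hx τ hτ ω) _ (by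
          rw [hr.price_eq τ hτ]
          exact Set.Ioo_subset_Icc_self (hpint _ (hr.ucb_mem τ hτ).1 _ (hx τ hτ ω)))
      calc _ ≤ ∑ t ∈ Finset.Icc 1 T, √Δbar *
            matNorm (designMatrix 1 (fun τ => feature (x τ ω) (p τ ω)) (t - 1))⁻¹
              (feature (x t ω) (p t ω)) :=
            Finset.sum_le_sum fun t ht => mul_le_mul_of_nonneg_right
              (Real.sqrt_le_sqrt (hω t ht)) (matNorm_nonneg _ _)
        _ = √Δbar * ∑ t ∈ Finset.Icc 1 T,
            matNorm (designMatrix 1 (fun τ => feature (x τ ω) (p τ ω)) (t - 1))⁻¹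
              (feature (x t ω) (p t ω)) := (Finset.mul_sum _ _ _).symm
        _ ≤ √Δbar * (√3 * √(T * d * Real.log ((2 * d + T) / (2 * d)))) := by gcongr
        _ ≤ _ := by
            gcongr
            exact Real.sqrt_le_iff.2 ⟨by norm_num, by norm_num⟩
    obtain ⟨hph, h⟩ := regret_le_of_gap_contribution_le hd hT g θstar Θ 𝒳 pstar θbar plow phigh glow ghigh σ hθbar hΘconv hΘ hθstar hpstar
      hpint hz hgmono hgdiff hglow hg P ℱ ε hσ hε x hx hxmeas p hpmeas hlik Δ θhat θcheck θucb hrun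
      (integrable_const _) hgap
    rw [integral_const, probReal_univ, one_smul] at h
    have he : √(2 * Δbar / glow) = √2 / √glow * √Δbar := by
      rw [← sqrt_two_div_mul hglow, div_mul_eq_mul_div]
    rw [he]
    have hs : √glow ≠ 0 := (Real.sqrt_pos.2 hglow).ne'
    refine (h.trans (le_of_eq ?_)).trans (le_add_of_nonneg_right hph.le)
    field_simp
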